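/- All graphs are finite, simple and undirected; $N[v]$ is the closed neighborhood of $v$. A *dominating sequence* of $G$ is a sequence $(v_1,\dots,v_k)$ of distinct vertices whose set is a dominating set of $G$ and such that $N[v_i]\setminus\bigcup_{j<i}N[v_j]\neq\emptyset$ for every $i$; the *Grundy domination number* $\gamma_{gr}(G)$ is the maximum length of a dominating sequence of $G$. For $G$ without isolated vertices, a *double dominating sequence* of $G$ is a sequence $(v_1,\dots,v_k)$ of distinct vertices whose set $D$ satisfies $|N[v]\cap D|\ge 2$ for every vertex $v$, and such that for every $i$ some vertex $u\in N[v_i]$ lies in at most one of the sets $N[v_1],\dots,N[v_{i-1}]$; the *Grundy double domination number* $\gamma_{gr}^{\times2}(G)$ is the maximum length of a double dominating sequence of $G$. Let $\mathcal F$ be a graph class (closed under isomorphism). The decision version of *Grundy Domination* for $\mathcal F$ asks, given $G\in\mathcal F$ and $k\in\mathbb N$, whether $\gamma_{gr}(G)\ge k$. The decision version of *Grundy Double Domination* for $\mathcal F$ asks, given $G\in\mathcal F$ without isolated vertices and $k\in\mathbb N$, whether $\gamma_{gr}^{\times2}(G)\ge k$. In both problems the inputs are promised to be of the stated form, a graph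 is encoded by its adjacency matrix, and $k$ is encoded in binary. A problem is NP-complete if it is in NP and every language in NP has a polynomial-time many-one reduction to it. **Corollary.** Suppose that $\mathcal F$ is closed under the addition of true twin vertices: whenever $G\in\mathcal F$ and $v\in V(G)$, the graph obtained from $G$ by adding a new vertex $v'$ with $N[v']=N[v]$ is also in $\mathcal F$. Then: 1. There is a polynomial-time many-one reduction from Grundy Domination for $\mathcal F$ to Grundy Double Domination for $\mathcal F$ that sends every instance $(G,k)$ to an instance $(G',2k)$, where $G'$ is isomorphic to the graph obtained from $G$ by adding exactly one true twin to each vertex of $G$. 2. If the decision version of Grundy Domination is NP-complete for $\mathcal F$, then the decision version of Grundy Double Domination is also NP-complete for $\mathcal F$. -/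

import Mathlib

namespace GrundyDom

/-! ### Domination sequences -/

section Graphs

variable {V : Type}

/-- The closed neighbourhood `N[v]`. -/
def closedNbhd (G : SimpleGraph V) (v : V) : Set V :=
  {u | u = v ∨ G.Adj v u}

/-- `D` is a dominating set of `G`. -/
def IsDominatingSet (G : SimpleGraph V) (D : Set V) : Prop :=
  ∀ v, v ∉ D → ∃ u ∈ D, G.Adj u v

/-- `D` is a double dominating set of `G`. -/
def IsDoubleDominatingSet (G : SimpleGraph V) (D : Set V) : Prop :=
  ∀ v, 2 ≤ (closedNbhd G v ∩ D).encard

/-- A legal sequence: distinct vertices, each of which dominates a vertex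
that no earlier vertex of the sequence dominates. (For the first vertex this is automatic.) -/
def IsLegalSequence (G : SimpleGraph V) (S : List V) : Prop :=
  S.Nodup ∧ ∀ i : Fin S.length,
    (closedNbhd G (S.get i) \ ⋃ j : Fin S.length, ⋃ _ : j < i, closedNbhd G (S.get j)).Nonempty

/-- A dominating sequence: a legal sequence whose vertices form a dominating set. -/
def IsDominatingSequence (G : SimpleGraph V) (S : List V) : Prop :=
  IsLegalSequence G S ∧ IsDominatingSet G {v | v ∈ S}

/-- The Grundy domination number: the maximum length of a dominating sequence. -/
noncomputable def grundyDominationNumber (G : SimpleGraph V) : ℕ :=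
  sSup {m | ∃ S : List V, IsDominatingSequence G S ∧ S.length = m}

/-- A double neighbourhood sequence: distinct vertices, each of which dominates a vertex
that is dominated by at most one earlier vertex of the sequence. -/
def IsDoubleNbhdSequence (G : SimpleGraph V) (S : List V) : Prop :=
  S.Nodup ∧ ∀ i : Fin S.length, ∃ u ∈ closedNbhd G (S.get i),
    {j : Fin S.length | j < i ∧ u ∈ closedNbhd G (S.get j)}.encard ≤ 1

/-- A double dominating sequence: a double neighbourhood sequence whose vertices form a
double dominating set. -/
def IsDoubleDominatingSequence (G : SimpleGraph V) (S : List V) : Prop :=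
  IsDoubleNbhdSequence G S ∧ IsDoubleDominatingSet G {v | v ∈ S}

/-- The Grundy double domination number: the maximum length of a double dominating sequence.
It is only used for graphs without isolated vertices. -/
noncomputable def grundyDoubleDominationNumber (G : SimpleGraph V) : ℕ :=
  sSup {m | ∃ S : List V, IsDoubleDominatingSequence G S ∧ S.length = m}

/-! ### True twins and graph classes -/

/-- The graph obtained from `G` by adding one new vertex `none` that is a true twin of `v`. -/
def addTrueTwin (G : SimpleGraph V) (v : V) : SimpleGraph (Option V) where
  Adj
    | some a, some b => G.Adj a b
    | some a, none => a ∈ closedNbhd G v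
    | none, some b => b ∈ closedNbhd G v
    | none, none => False
  symm := ⟨by
    rintro (_ | a) (_ | b) h
    · exact h
    · exact h
    · exact h
    · exact h.symm⟩
  loopless := ⟨by
    rintro (_ | a) h
    · exact h
    · exact G.irrefl h⟩

/-- The graph `G_f`, obtained from `G` by adding exactly `f v` true twins to each vertex `v`. -/
def addTrueTwins (G : SimpleGraph V) (f : V → ℕ) : SimpleGraph (Σ v : V, Fin (f v + 1)) where
  Adj p q := p ≠ q ∧ (p.1 = q.1 ∨ G.Adj p.1 q.1)
  symm := ⟨fun _ _ h => ⟨h.1.symm, h.2.imp Eq.symm fun hh => hh.symm⟩⟩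
  loopless := ⟨fun _ h => h.1 rfl⟩

end Graphs

/-- A class of finite graphs, closed under isomorphism. -/
structure GraphClass where
  Mem : ∀ (V : Type) [Finite V], SimpleGraph V → Prop
  iso : ∀ {V W : Type} [Finite V] [Finite W] {G : SimpleGraph V} {H : SimpleGraph W},
    Nonempty (G ≃g H) → Mem V G → Mem W H

/-- Closure of a graph class under the addition of true twin vertices. -/
def GraphClass.ClosedUnderTrueTwins (F : GraphClass) : Prop :=
  ∀ (V : Type) [Finite V] (G : SimpleGraph V) (v : V),
    F.Mem V G → F.Mem (Option V) (addTrueTwin G v)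

/-! ### Decision problems and NP-completeness

Polynomial time means computable by a multi-tape Turing machine of the kind
`Turing.FinTM2` within a number of steps polynomial in the length of the encoded input. -/

/-- A decision problem: instances, a reasonable encoding of them by bit strings, and the set of
yes-instances. -/
structure DecisionProblem where
  Inst : Type
  encode : Inst → List Bool
  encode_injective : Function.Injective encode
  IsYes : Inst → Prop

/-- The membership problem of a language over `{0,1}`. -/
def DecisionProblem.ofLanguage (L : Set (List Bool)) : DecisionProblem where
  Inst := List Bool
  encode := id
  encode_injective := Function.injective_id
  IsYes x := x ∈ L

/-- The problem `P` restricted to the instances that satisfy `D`. -/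
def DecisionProblem.restrict (P : DecisionProblem) (D : P.Inst → Prop) : DecisionProblem where
  Inst := {x : P.Inst // D x}
  encode x := P.encode x.1
  encode_injective := P.encode_injective.comp Subtype.val_injective
  IsYes x := P.IsYes x.1

/-- The encoding of an instance together with a certificate. The symbols of the two parts are
distinguished by a tag. -/
def DecisionProblem.encodeWithCertificate (P : DecisionProblem) (x : P.Inst × List Bool) :
    List (Bool ⊕ Bool) :=
  (P.encode x.1).map Sum.inl ++ x.2.map Sum.inr

/-- `P` is in NP: there is a polynomial-time verifier for certificates of polynomial length. -/
def InNP (P : DecisionProblem) : Prop :=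
  ∃ (verify : P.Inst × List Bool → Bool) (p : Polynomial ℕ),
    Nonempty (Turing.TM2ComputableInPolyTime P.encodeWithCertificate
      Computability.encodeBool verify) ∧
    ∀ x, P.IsYes x ↔
      ∃ w : List Bool, w.length ≤ p.eval (P.encode x).length ∧ verify (x, w) = true

/-- `r` is a polynomial-time many-one (Karp) reduction from `P` to `Q`. -/
def IsPolyReduction (P Q : DecisionProblem) (r : P.Inst → Q.Inst) : Prop :=
  Nonempty (Turing.TM2ComputableInPolyTime P.encode Q.encode r) ∧
    ∀ x, P.IsYes x ↔ Q.IsYes (r x)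

/-- Every language in NP has a polynomial-time reduction to `P`. -/
def NPHard (P : DecisionProblem) : Prop :=
  ∀ L : Set (List Bool), InNP (DecisionProblem.ofLanguage L) →
    ∃ r, IsPolyReduction (DecisionProblem.ofLanguage L) P r

def NPComplete (P : DecisionProblem) : Prop :=
  InNP P ∧ NPHard P

/-! ### The two problems -/

/-- A graph on the vertices `0, …, n - 1` and a bound. -/
@[ext]
structure GraphInst where
  n : ℕ
  graph : SimpleGraph (Fin n)
  bound : ℕ

/-- The rows of the adjacency matrix, one after the other. -/
noncomputable def encodeAdj {n : ℕ} (G : SimpleGraph (Fin n)) : List Bool :=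
  open Classical in
  (List.finRange n).flatMap fun i => (List.finRange n).map fun j => decide (G.Adj i j)

/-- The string `1ⁿ 0`, then the adjacency matrix, then the bound in binary. -/
noncomputable def GraphInst.encode (x : GraphInst) : List Bool :=
  List.replicate x.n true ++ false :: (encodeAdj x.graph ++ Computability.encodeNat x.bound)

theorem length_encodeAdj {n : ℕ} (G : SimpleGraph (Fin n)) : (encodeAdj G).length = n * n := by
  simp [encodeAdj, List.length_flatMap]

theorem flatMap_inj {α β : Type} (f g : α → List β) (h : ∀ a, (f a).length = (g a).length) :
    ∀ l : List α, l.flatMap f = l.flatMap g → ∀ a ∈ l, f a = g a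
  | [], _, a, ha => by simp at ha
  | b :: l, hl, a, ha => by
    rw [List.flatMap_cons, List.flatMap_cons] at hl
    obtain ⟨h1, h2⟩ := List.append_inj hl (h b)
    rcases List.mem_cons.1 ha with rfl | ha
    · exact h1
    · exact flatMap_inj f g h l h2 a ha

theorem encodeAdj_injective (n : ℕ) :
    Function.Injective (encodeAdj : SimpleGraph (Fin n) → List Bool) := by
  classical
  intro G H h
  ext i j
  have h1 := flatMap_inj _ _ (by simp) _ h i (List.mem_finRange i)
  have h2 := List.map_inj_left.1 h1 j (List.mem_finRange j)
  simpa using h2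

theorem replicate_true_inj : ∀ (m n : ℕ) (a b : List Bool),
    List.replicate m true ++ false :: a = List.replicate n true ++ false :: b → m = n ∧ a = b
  | 0, 0, a, b, h => by simpa using h
  | 0, n + 1, a, b, h => by simp [List.replicate_succ] at h
  | m + 1, 0, a, b, h => by simp [List.replicate_succ] at h
  | m + 1, n + 1, a, b, h => by
    have h' : List.replicate m true ++ false :: a = List.replicate n true ++ false :: b := by
      simpa [List.replicate_succ] using h
    obtain ⟨h1, h2⟩ := replicate_true_inj m n a b h'
    exact ⟨congrArg _ h1, h2⟩

theorem GraphInst.encode_injective : Function.Injective GraphInst.encode := by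
  rintro ⟨m, G, k⟩ ⟨n, H, l⟩ h
  obtain ⟨h1, h2⟩ := replicate_true_inj _ _ _ _ h
  dsimp only at h1
  subst h1
  obtain ⟨h3, h4⟩ := List.append_inj h2 (by rw [length_encodeAdj, length_encodeAdj])
  have h5 : G = H := encodeAdj_injective _ h3
  have h6 : k = l := by
    have := congrArg Computability.decodeNat h4
    simpa using this
  subst h5 h6
  rfl

/-- Grundy Domination: given `(G, k)`, is the Grundy domination number of `G` at least `k`? -/
noncomputable def grundyDomination : DecisionProblem where
  Inst := GraphInst
  encode := GraphInst.encode
  encode_injective := GraphInst.encode_injective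
  IsYes x := x.bound ≤ grundyDominationNumber x.graph

/-- Grundy Double Domination: given `(G, k)`, where `G` has no isolated vertices, is the Grundy
double domination number of `G` at least `k`? -/
noncomputable def grundyDoubleDomination : DecisionProblem where
  Inst := {x : GraphInst // ∀ v, ¬ x.graph.IsIsolated v}
  encode x := x.1.encode
  encode_injective := GraphInst.encode_injective.comp Subtype.val_injective
  IsYes x := x.1.bound ≤ grundyDoubleDominationNumber x.1.graph

/-- Grundy Domination on the graphs of `F`. -/
noncomputable def grundyDominationOn (F : GraphClass) : DecisionProblem :=
  grundyDomination.restrict fun x : GraphInst => F.Mem (Fin x.n) x.graph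

/-- Grundy Double Domination on the graphs of `F` without isolated vertices. -/
noncomputable def grundyDoubleDominationOn (F : GraphClass) : DecisionProblem :=
  grundyDoubleDomination.restrict
    fun x : {x : GraphInst // ∀ v, ¬ x.graph.IsIsolated v} => F.Mem (Fin x.1.n) x.1.graph

/-- The graph and the bound of an instance of `grundyDominationOn F`. -/
def grundyDominationOn.toGraphInst {F : GraphClass} (x : (grundyDominationOn F).Inst) :
    GraphInst :=
  x.1

/-- The graph and the bound of an instance of `grundyDoubleDominationOn F`. -/
def grundyDoubleDominationOn.toGraphInst {F : GraphClass}
    (x : (grundyDoubleDominationOn F).Inst) : GraphInst :=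
  x.1.1

end GrundyDom

/-!
Let `G'` arise from `G` by adding one true twin to every vertex. The combinatorial heart is that
the Grundy double domination number of `G'` is twice the Grundy domination number of `G`
(`le_grundyDoubleDominationNumber_iff_of_twins`).

A sequence that satisfies the legality condition but does not dominate can be prolonged, so both
Grundy numbers are maximum lengths of merely legal sequences (`le_grundyDominationNumber_iff`,
`le_grundyDoubleDominationNumber_iff`). If `v₁, …, v_k` is legal for domination in `G`, then
`v₁, v₁', …, v_k, v_k'` is legal for double domination in `G'` (`Legal.flatMap_pair`). Conversely,
a sequence that is legal for double domination splits into two sequences that are legal for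
domination (`Legal.exists_split`): each member has a footprint that is dominated at most once
before, hence not at all by one of the two parts built so far, and the member is appended to that
part. Projected to `G`, the longer part has at least half of the length. The graph `G'` has no
isolated vertices, and it lies in the class because it arises by adding twins one at a time
(`GraphClass.ClosedUnderTrueTwins.mem_of_isBlowup`).

Polynomial time refers to the machines `Turing.FinTM2`, so it remains to produce such machines.
Programs with counters and a read-only input tape compile to them step by step (`Exec.stepsTo`).
Arithmetic expressions with bounded sums and bounded recursion, whose values are polynomially
bounded, compile to such programs that run in polynomial time (`Expr.exists_execIn_compile`).
Therefore every function whose output length and output bits are given by expressions is computable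
in polynomial time (`Expr.nonempty_computableInPolyTime`). This covers the reduction, where the
adjacency matrix of `G'` is read off that of `G` (`Expr.output_double`), and a verifier for Grundy
double domination (`Expr.eval_verifier`), whose certificates list vertices in unary. The second
problem is thus in NP, and hardness is transferred by composing reductions, which requires the
composition of polynomial-time machines (`nonempty_computableInPolyTime_comp`).
-/

/-! ### Legal sequences -/

namespace GrundyDom

section Legal

variable {V : Type}

open scoped Classical in
/-- The number of members of the sequence `S` that dominate `u`. -/
noncomputable def domCount (G : SimpleGraph V) (S : List V) (u : V) : ℕ :=
  S.countP fun w => decide (u ∈ closedNbhd G w)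

/-- Every member of `S` dominates a vertex that fewer than `c` earlier members dominate. For
`c = 1` and `c = 2` these are the conditions on the footprints of dominating and of double
dominating sequences. -/
def Legal (G : SimpleGraph V) (c : ℕ) (S : List V) : Prop :=
  ∀ i (hi : i < S.length), ∃ u ∈ closedNbhd G S[i], domCount G (S.take i) u < c

variable {G : SimpleGraph V} {c : ℕ} {S T : List V} {u v w : V}

theorem domCount_append : domCount G (S ++ T) u = domCount G S u + domCount G T u := by
  classical
  exact List.countP_append

theorem domCount_singleton_le : domCount G [v] u ≤ 1 := by
  classical
  exact (List.countP_le_length).trans (by simp)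

theorem domCount_pos : 0 < domCount G S u ↔ ∃ w ∈ S, u ∈ closedNbhd G w := by
  classical
  simp [domCount, List.countP_pos_iff]

theorem self_mem_closedNbhd : v ∈ closedNbhd G v := Or.inl rfl

theorem mem_closedNbhd_comm : u ∈ closedNbhd G v ↔ v ∈ closedNbhd G u := by
  simp [closedNbhd, eq_comm, G.adj_comm]

theorem legal_nil : Legal G c [] := fun i hi => absurd hi (Nat.not_lt_zero i)

theorem legal_append_singleton :
    Legal G c (S ++ [v]) ↔ Legal G c S ∧ ∃ u ∈ closedNbhd G v, domCount G S u < c := by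
  constructor
  · intro h
    refine ⟨fun i hi => ?_, ?_⟩
    · obtain ⟨u, hu, hc⟩ := h i (by simp; omega)
      rw [List.getElem_append_left hi] at hu
      rw [List.take_append_of_le_length hi.le] at hc
      exact ⟨u, hu, hc⟩
    · obtain ⟨u, hu, hc⟩ := h S.length (by simp)
      exact ⟨u, by simpa using hu, by simpa using hc⟩
  · rintro ⟨h, u, hu, hc⟩ i hi
    rw [List.length_append, List.length_singleton] at hi
    rcases Nat.lt_or_ge i S.length with h' | h'
    · rw [List.getElem_append_left h', List.take_append_of_le_length h'.le]
      exact h i h'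
    · obtain rfl : i = S.length := by omega
      exact ⟨u, by simpa using hu, by simpa using hc⟩

theorem Legal.take (h : Legal G c S) (n : ℕ) : Legal G c (S.take n) := by
  intro i hi
  rw [List.length_take] at hi
  obtain ⟨u, hu, hc⟩ := h i (by omega)
  refine ⟨u, by simpa using hu, ?_⟩
  rwa [List.take_take, min_eq_left (by omega)]

theorem Legal.nodup (h : Legal G 1 S) : S.Nodup := by
  induction S using List.reverseRecOn with
  | nil => exact List.nodup_nil
  | append_singleton S v ih =>
    obtain ⟨h, u, hu, hc⟩ := legal_append_singleton.1 h
    refine List.nodup_append.2 ⟨ih h, List.nodup_singleton v, ?_⟩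
    rintro a ha b hb rfl
    rw [List.mem_singleton] at hb
    subst hb
    exact (domCount_pos.2 ⟨a, ha, hu⟩).ne' (by omega)

/-- The earlier members of a sequence that dominate `u`, counted by their positions. -/
theorem encard_earlier (S : List V) (i : Fin S.length) (u : V) :
    {j : Fin S.length | j < i ∧ u ∈ closedNbhd G (S.get j)}.encard =
      (domCount G (S.take i) u : ℕ∞) := by
  classical
  have key : ∀ T : List V, {j : Fin T.length | u ∈ closedNbhd G (T.get j)}.encard =
      (domCount G T u : ℕ∞) := by
    intro T
    have h₁ : (T : Multiset V) = (Finset.univ : Finset (Fin T.length)).val.map T.get := by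
      rw [Fin.univ_val_map, List.ofFn_get]
    have h₂ : domCount G T u = (Finset.univ.filter
        fun j : Fin T.length => u ∈ closedNbhd G (T.get j)).card := by
      rw [domCount, ← Multiset.coe_countP, Multiset.countP_congr h₁ fun _ _ => rfl,
        Multiset.countP_map]
      rfl
    rw [h₂, ← Set.encard_coe_eq_coe_finsetCard]
    simp
  rw [← key, ← Fin.val_injective.encard_image,
    ← (Fin.val_injective (n := (S.take i).length)).encard_image]
  congr 1
  ext j
  simp only [Set.mem_image, Set.mem_ofPred_eq, List.get_eq_getElem, List.getElem_take]
  constructor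
  · rintro ⟨j, ⟨hj, hu⟩, rfl⟩
    exact ⟨⟨j, by simp; omega⟩, hu, rfl⟩
  · rintro ⟨⟨j, hj⟩, hu, rfl⟩
    rw [List.length_take] at hj
    exact ⟨⟨j, by omega⟩, ⟨Fin.lt_def.2 (by simp; omega), hu⟩, rfl⟩

theorem isLegalSequence_iff : IsLegalSequence G S ↔ Legal G 1 S := by
  have key : (∀ i : Fin S.length, (closedNbhd G (S.get i) \ ⋃ j : Fin S.length, ⋃ _ : j < i,
      closedNbhd G (S.get j)).Nonempty) ↔ Legal G 1 S := by
    rw [Legal, Fin.forall_iff]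
    refine forall₂_congr fun i hi => exists_congr fun u => and_congr_right fun _ => ?_
    rw [Nat.lt_one_iff, ← Nat.cast_eq_zero (R := ℕ∞), ← encard_earlier S ⟨i, hi⟩,
      Set.encard_eq_zero, Set.eq_empty_iff_forall_notMem]
    simp
  exact (and_congr_right fun _ => key).trans ⟨fun h => h.2, fun h => ⟨h.nodup, h⟩⟩

theorem isDoubleNbhdSequence_iff : IsDoubleNbhdSequence G S ↔ S.Nodup ∧ Legal G 2 S := by
  refine and_congr_right fun _ => ?_
  rw [Legal, Fin.forall_iff]
  refine forall₂_congr fun i hi => exists_congr fun u => and_congr_right fun _ => ?_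
  rw [encard_earlier S ⟨i, hi⟩, ← Nat.cast_one, Nat.cast_le, Nat.lt_succ_iff]

/-- If a sequence with `P` that lacks `Q` can always be extended within `P`, then every sequence
with `P` is at most as long as one with `P` and `Q`. -/
theorem exists_extension [Finite V] {P Q : List V → Prop} (hP : ∀ S, P S → S.Nodup)
    (hQ : ∀ S, P S → ¬ Q S → ∃ v, P (S ++ [v])) (S : List V) (hS : P S) :
    ∃ T, P T ∧ Q T ∧ S.length ≤ T.length := by
  classical
  have := Fintype.ofFinite V
  obtain ⟨n, hn⟩ : ∃ n, n = Fintype.card V - S.length := ⟨_, rfl⟩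
  induction n generalizing S with
  | zero =>
    by_cases h : Q S
    · exact ⟨S, hS, h, le_rfl⟩
    · obtain ⟨v, hv⟩ := hQ S hS h
      have := (hP _ hv).length_le_card
      rw [List.length_append, List.length_singleton] at this
      omega
  | succ n ih =>
    by_cases h : Q S
    · exact ⟨S, hS, h, le_rfl⟩
    · obtain ⟨v, hv⟩ := hQ S hS h
      have hl : (S ++ [v]).length = S.length + 1 := by simp
      obtain ⟨T, h₁, h₂, h₃⟩ := ih (S ++ [v]) hv (by omega)
      exact ⟨T, h₁, h₂, by omega⟩

/-- The condition `Q` is irrelevant for the maximum length, if it can always be reached by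
extending a sequence with `P`. -/
theorem le_sSup_length_iff [Finite V] {P Q : List V → Prop} (hP : ∀ S, P S → S.Nodup)
    (hnil : P []) (hQ : ∀ S, P S → ¬ Q S → ∃ v, P (S ++ [v])) (k : ℕ) :
    k ≤ sSup {m | ∃ S : List V, (P S ∧ Q S) ∧ S.length = m} ↔ ∃ S, P S ∧ k ≤ S.length := by
  have := Fintype.ofFinite V
  have hbdd : BddAbove {m | ∃ S : List V, (P S ∧ Q S) ∧ S.length = m} := by
    refine ⟨Fintype.card V, ?_⟩
    rintro _ ⟨S, ⟨hS, _⟩, rfl⟩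
    exact (hP S hS).length_le_card
  constructor
  · intro h
    have hne : {m | ∃ S : List V, (P S ∧ Q S) ∧ S.length = m}.Nonempty := by
      obtain ⟨T, h₁, h₂, _⟩ := exists_extension hP hQ [] hnil
      exact ⟨_, T, ⟨h₁, h₂⟩, rfl⟩
    obtain ⟨S, ⟨hS, _⟩, hl⟩ := Nat.sSup_mem hne hbdd
    exact ⟨S, hS, by omega⟩
  · rintro ⟨S, hS, hk⟩
    obtain ⟨T, h₁, h₂, h₃⟩ := exists_extension hP hQ S hS
    exact (hk.trans h₃).trans (le_csSup hbdd ⟨T, ⟨h₁, h₂⟩, rfl⟩)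

theorem le_grundyDominationNumber_iff [Finite V] (G : SimpleGraph V) (k : ℕ) :
    k ≤ grundyDominationNumber G ↔ ∃ S, Legal G 1 S ∧ k ≤ S.length := by
  have h := le_sSup_length_iff (P := Legal G 1) (Q := fun S => IsDominatingSet G {v | v ∈ S})
    (fun S hS => hS.nodup) legal_nil (fun S hS hQ => ?_) k
  · rw [← h, grundyDominationNumber]
    simp only [IsDominatingSequence, isLegalSequence_iff]
  · -- an undominated vertex can be appended: it is its own footprint
    simp only [IsDominatingSet, not_forall, not_exists, not_and] at hQ
    obtain ⟨v, hv, hd⟩ := hQ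
    refine ⟨v, legal_append_singleton.2 ⟨hS, v, self_mem_closedNbhd, ?_⟩⟩
    by_contra hc
    obtain ⟨w, hw, hvw⟩ := domCount_pos.1 (by omega : 0 < domCount G S v)
    rcases hvw with rfl | hvw
    · exact hv hw
    · exact hd w hw hvw

theorem domCount_le_encard (hS : S.Nodup) (v : V) :
    (domCount G S v : ℕ∞) ≤ (closedNbhd G v ∩ {w | w ∈ S}).encard := by
  classical
  have h : domCount G S v = (S.filter fun w => decide (v ∈ closedNbhd G w)).toFinset.card := by
    rw [List.toFinset_card_of_nodup (hS.filter _), domCount, List.countP_eq_length_filter]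
  rw [h, ← Set.encard_coe_eq_coe_finsetCard]
  refine Set.encard_le_encard fun w hw => ?_
  simp only [List.coe_toFinset, List.mem_filter, decide_eq_true_eq, Set.mem_ofPred_eq] at hw
  exact ⟨mem_closedNbhd_comm.1 hw.2, hw.1⟩

theorem le_grundyDoubleDominationNumber_iff [Finite V] (G : SimpleGraph V)
    (hG : ∀ v, ¬ G.IsIsolated v) (k : ℕ) :
    k ≤ grundyDoubleDominationNumber G ↔ ∃ S : List V, (S.Nodup ∧ Legal G 2 S) ∧ k ≤ S.length := by
  have h := le_sSup_length_iff (P := fun S => S.Nodup ∧ Legal G 2 S)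
    (Q := fun S => IsDoubleDominatingSet G {v | v ∈ S})
    (fun S hS => hS.1) ⟨List.nodup_nil, legal_nil⟩ (fun S hS hQ => ?_) k
  · rw [← h, grundyDoubleDominationNumber]
    simp only [IsDoubleDominatingSequence, isDoubleNbhdSequence_iff]
  · -- if `v` is dominated at most once, then a member of `N[v]` outside of `S` can be appended
    simp only [IsDoubleDominatingSet, not_forall, not_le] at hQ
    obtain ⟨v, hv⟩ := hQ
    obtain ⟨w, hw, hwS⟩ : ∃ w ∈ closedNbhd G v, w ∉ S := by
      by_contra! hsub
      obtain ⟨w, hw⟩ : ∃ w, G.Adj v w := by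
        by_contra! hno
        exact hG v hno
      have h₂ : ({v, w} : Set V) ⊆ closedNbhd G v ∩ {w | w ∈ S} := by
        rintro x (rfl | rfl)
        · exact ⟨self_mem_closedNbhd, hsub _ self_mem_closedNbhd⟩
        · exact ⟨Or.inr hw, hsub _ (Or.inr hw)⟩
      have := Set.encard_le_encard h₂
      rw [Set.encard_pair hw.ne] at this
      exact absurd hv (not_lt.2 this)
    refine ⟨w, ?_, legal_append_singleton.2 ⟨hS.2, v, mem_closedNbhd_comm.1 hw, ?_⟩⟩
    · refine List.nodup_append.2 ⟨hS.1, List.nodup_singleton w, ?_⟩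
      rintro a ha b hb rfl
      rw [List.mem_singleton] at hb
      exact hwS (hb ▸ ha)
    · have := (domCount_le_encard (G := G) hS.1 v).trans_lt hv
      exact_mod_cast this

end Legal

/-! ### Grundy numbers of a graph with doubled vertices -/

section Twins

variable {V W : Type} {G : SimpleGraph V} {H : SimpleGraph W}

/-- A sequence in which every member has a footprint with at most one earlier dominator splits
into two sequences in which every footprint is new: the footprint of the last member is dominated
at most once, hence by none of the earlier members of one of the two parts. -/
theorem Legal.exists_split {S : List V} (h : Legal G 2 S) :
    ∃ S₁ S₂, Legal G 1 S₁ ∧ Legal G 1 S₂ ∧ (S₁ ++ S₂).Perm S := by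
  induction S using List.reverseRecOn with
  | nil => exact ⟨[], [], legal_nil, legal_nil, by simp⟩
  | append_singleton S v ih =>
    obtain ⟨h, u, hu, hc⟩ := legal_append_singleton.1 h
    obtain ⟨S₁, S₂, h₁, h₂, hp⟩ := ih h
    have hcount : domCount G S₁ u + domCount G S₂ u = domCount G S u := by
      rw [← domCount_append]
      exact hp.countP_eq _
    by_cases h0 : domCount G S₁ u = 0
    · refine ⟨S₁ ++ [v], S₂, legal_append_singleton.2 ⟨h₁, u, hu, by omega⟩, h₂, ?_⟩
      rw [List.append_assoc]
      exact (List.perm_append_comm.append_left S₁).trans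
        ((List.append_assoc _ _ _).symm ▸ hp.append_right [v])
    · refine ⟨S₁, S₂ ++ [v], h₁, legal_append_singleton.2 ⟨h₂, u, hu, by omega⟩, ?_⟩
      rw [← List.append_assoc]
      exact hp.append_right [v]

theorem domCount_map {π : W → V}
    (hπ : ∀ a b, a ∈ closedNbhd H b ↔ π a ∈ closedNbhd G (π b)) (S : List W) (a : W) :
    domCount G (S.map π) (π a) = domCount H S a := by
  classical
  simp only [domCount, List.countP_map]
  refine List.countP_congr fun b _ => ?_
  simp [hπ]

/-- Projecting along the twin classes preserves legality, although members may coincide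
afterwards. -/
theorem Legal.map {π : W → V}
    (hπ : ∀ a b, a ∈ closedNbhd H b ↔ π a ∈ closedNbhd G (π b)) {c : ℕ}
    {S : List W} (h : Legal H c S) : Legal G c (S.map π) := by
  induction S using List.reverseRecOn with
  | nil => exact legal_nil
  | append_singleton S v ih =>
    obtain ⟨h, u, hu, hc⟩ := legal_append_singleton.1 h
    rw [List.map_append]
    exact legal_append_singleton.2 ⟨ih h, π u, (hπ _ _).1 hu, by rwa [domCount_map hπ]⟩

/-- Writing both twins of each member one after the other turns footprints that are new into
footprints that are dominated at most once: `s₀ u` serves `s₀ v` and then `s₁ v`. -/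
theorem Legal.flatMap_pair {π : W → V}
    (hπ : ∀ a b, a ∈ closedNbhd H b ↔ π a ∈ closedNbhd G (π b)) {s₀ s₁ : V → W}
    (h₀ : ∀ v, π (s₀ v) = v) (h₁ : ∀ v, π (s₁ v) = v)
    (hne : ∀ v, s₀ v ≠ s₁ v) {S : List V} (h : Legal G 1 S) :
    (S.flatMap fun v => [s₀ v, s₁ v]).Nodup ∧ Legal H 2 (S.flatMap fun v => [s₀ v, s₁ v]) := by
  induction S using List.reverseRecOn with
  | nil => exact ⟨List.nodup_nil, legal_nil⟩
  | append_singleton S v ih =>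
    have hvS : v ∉ S := by
      have := h.nodup
      rw [List.nodup_append] at this
      exact fun hv => this.2.2 v hv v (by simp) rfl
    obtain ⟨h, u, hu, hc⟩ := legal_append_singleton.1 h
    obtain ⟨ih₁, ih₂⟩ := ih h
    set T := S.flatMap fun v => [s₀ v, s₁ v] with hT
    have hmem : ∀ a ∈ T, π a ∈ S := by
      intro a ha
      obtain ⟨b, hb, ha⟩ := List.mem_flatMap.1 ha
      simp only [List.mem_cons, List.not_mem_nil, or_false] at ha
      rcases ha with rfl | rfl <;> simpa [h₀, h₁]
    have hT0 : domCount H T (s₀ u) = 0 := by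
      by_contra hpos
      obtain ⟨a, ha, hua⟩ := domCount_pos.1 (Nat.pos_of_ne_zero hpos)
      rw [hπ, h₀] at hua
      exact (domCount_pos.2 ⟨_, hmem a ha, hua⟩).ne' (by omega)
    have e : (S ++ [v]).flatMap (fun v => [s₀ v, s₁ v]) = (T ++ [s₀ v]) ++ [s₁ v] := by
      simp [hT]
    rw [e]
    refine ⟨?_, legal_append_singleton.2 ⟨legal_append_singleton.2 ⟨ih₂, s₀ u, ?_, by omega⟩,
      s₀ u, ?_, ?_⟩⟩
    · have n₀ : s₀ v ∉ T := fun hm => hvS (h₀ v ▸ hmem _ hm)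
      have n₁ : s₁ v ∉ T := fun hm => hvS (h₁ v ▸ hmem _ hm)
      simp only [List.nodup_append, ih₁, List.nodup_singleton, List.mem_singleton, List.mem_append,
        true_and]
      grind
    · rwa [hπ, h₀, h₀]
    · rwa [hπ, h₀, h₁]
    · rw [domCount_append, hT0]
      have := domCount_singleton_le (G := H) (v := s₀ v) (u := s₀ u)
      omega

/-- If `H` arises from `G` by doubling every vertex, then its Grundy double domination number is
twice the Grundy domination number of `G`. -/
theorem le_grundyDoubleDominationNumber_iff_of_twins {π : W → V}
    (hπ : ∀ a b, a ∈ closedNbhd H b ↔ π a ∈ closedNbhd G (π b)) [Finite V] [Finite W]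
    {s₀ s₁ : V → W}
    (h₀ : ∀ v, π (s₀ v) = v) (h₁ : ∀ v, π (s₁ v) = v) (hne : ∀ v, s₀ v ≠ s₁ v)
    (hH : ∀ w, ¬ H.IsIsolated w) (k : ℕ) :
    2 * k ≤ grundyDoubleDominationNumber H ↔ k ≤ grundyDominationNumber G := by
  rw [le_grundyDoubleDominationNumber_iff H hH, le_grundyDominationNumber_iff]
  constructor
  · rintro ⟨S, ⟨_, hS⟩, hk⟩
    obtain ⟨S₁, S₂, hS₁, hS₂, hp⟩ := (Legal.map hπ hS).exists_split
    have := hp.length_eq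
    rw [List.length_append, List.length_map] at this
    rcases Nat.lt_or_ge S₁.length k with h | h
    · exact ⟨S₂, hS₂, by omega⟩
    · exact ⟨S₁, hS₁, h⟩
  · rintro ⟨S, hS, hk⟩
    refine ⟨_, Legal.flatMap_pair hπ h₀ h₁ hne hS, ?_⟩
    have : (S.flatMap fun v => [s₀ v, s₁ v]).length = S.length * 2 := by
      simp [List.length_flatMap]
    omega

end Twins

end GrundyDom

/-! ### Doubling the vertices of a graph -/

namespace GrundyDom

/-- `H` arises from `G` by replacing every vertex `v` by the clique `π ⁻¹ {v}`. -/
def IsBlowup {V W : Type} (G : SimpleGraph V) (H : SimpleGraph W) (π : W → V) : Prop :=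
  ∀ a b, H.Adj a b ↔ a ≠ b ∧ (π a = π b ∨ G.Adj (π a) (π b))

theorem IsBlowup.mem_closedNbhd {V W : Type} {G : SimpleGraph V} {H : SimpleGraph W} {π : W → V}
    (h : IsBlowup G H π) (a b : W) : a ∈ closedNbhd H b ↔ π a ∈ closedNbhd G (π b) := by
  have : (a = b ∨ H.Adj b a) ↔ (π a = π b ∨ G.Adj (π b) (π a)) := by
    rw [h]
    grind
  exact this

/-- A class that is closed under the addition of true twins is closed under blowing up vertices to
cliques. If two vertices `a ≠ b` are blown up from the same vertex, then `b` is a true twin of `a`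
that can be removed. -/
theorem GraphClass.ClosedUnderTrueTwins.mem_of_isBlowup {F : GraphClass}
    (hF : F.ClosedUnderTrueTwins) {V : Type} [Finite V] {G : SimpleGraph V} (hG : F.Mem V G)
    {W : Type} [Finite W] {H : SimpleGraph W} {π : W → V} (hπ : Function.Surjective π)
    (h : IsBlowup G H π) : F.Mem W H := by
  classical
  obtain ⟨n, hn⟩ : ∃ n, n = Nat.card W := ⟨_, rfl⟩
  induction n generalizing W with
  | zero =>
    have hW : IsEmpty W := by
      rcases Finite.card_eq_zero_iff.1 hn.symm with h
      exact h
    have hbij : Function.Bijective π := ⟨fun a => hW.elim a, hπ⟩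
    exact F.iso ⟨((⟨Equiv.ofBijective π hbij, fun {a} => hW.elim a⟩ : H ≃g G)).symm⟩ hG
  | succ n ih =>
    by_cases hinj : Function.Injective π
    · refine F.iso ⟨((⟨Equiv.ofBijective π ⟨hinj, hπ⟩, fun {a b} => ?_⟩ : H ≃g G)).symm⟩ hG
      rw [h]
      change G.Adj (π a) (π b) ↔ _
      constructor
      · exact fun hab => ⟨fun e => G.irrefl (e ▸ hab), Or.inr hab⟩
      · rintro ⟨hne, e | hab⟩
        · exact absurd (hinj e) hne
        · exact hab
    · obtain ⟨a, b, hab, hne⟩ : ∃ a b, π a = π b ∧ a ≠ b := by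
        simpa [Function.Injective] using hinj
      set H' : SimpleGraph {w // w ≠ b} := H.comap Subtype.val with hH'
      have h' : IsBlowup G H' fun w => π w.1 := by
        intro x y
        rw [hH', SimpleGraph.comap_adj, h, Ne, Ne, Subtype.ext_iff]
      have hcard : n = Nat.card {w // w ≠ b} := by
        have := Nat.card_congr (Equiv.optionSubtypeNe b)
        rw [Finite.card_option] at this
        omega
      have hmem : F.Mem _ H' := by
        refine ih (fun v => ?_) h' hcard
        obtain ⟨w, rfl⟩ := hπ v
        by_cases hw : w = b
        · exact ⟨⟨a, hne⟩, by rw [hw]; exact hab⟩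
        · exact ⟨⟨w, hw⟩, rfl⟩
      refine F.iso ⟨⟨Equiv.optionSubtypeNe b, ?_⟩⟩ (hF _ H' ⟨a, hne⟩ hmem)
      rintro (_ | ⟨x, hx⟩) (_ | ⟨y, hy⟩)
      · simp [addTrueTwin]
      · simp only [Equiv.optionSubtypeNe_none, Equiv.optionSubtypeNe_some, addTrueTwin]
        have := h'.mem_closedNbhd ⟨y, hy⟩ ⟨a, hne⟩
        rw [this, h, ← hab, closedNbhd]
        simp only [Set.mem_ofPred_eq]
        grind
      · simp only [Equiv.optionSubtypeNe_none, Equiv.optionSubtypeNe_some, addTrueTwin]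
        have := h'.mem_closedNbhd ⟨x, hx⟩ ⟨a, hne⟩
        rw [this, h, ← hab, closedNbhd]
        simp only [Set.mem_ofPred_eq]
        rw [G.adj_comm]
        grind
      · simp [addTrueTwin, hH']

/-- The graph on `0, …, 2 n - 1` in which `2 v` and `2 v + 1` are twins that replace `v`. -/
def doubled {n : ℕ} (G : SimpleGraph (Fin n)) : SimpleGraph (Fin (n * 2)) where
  Adj a b := a ≠ b ∧ (a.divNat = b.divNat ∨ G.Adj a.divNat b.divNat)
  symm := ⟨fun _ _ h => ⟨h.1.symm, h.2.imp Eq.symm fun h => h.symm⟩⟩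
  loopless := ⟨fun _ h => h.1 rfl⟩

section Doubled

variable {n : ℕ} (G : SimpleGraph (Fin n))

theorem isBlowup_doubled : IsBlowup G (doubled G) Fin.divNat := fun _ _ => Iff.rfl

theorem divNat_finProdFinEquiv (v : Fin n) (i : Fin 2) :
    (finProdFinEquiv (v, i)).divNat = v :=
  congrArg Prod.fst (finProdFinEquiv.symm_apply_apply (v, i))

theorem not_isIsolated_doubled (w : Fin (n * 2)) : ¬ (doubled G).IsIsolated w := by
  intro hw
  obtain ⟨⟨v, i⟩, rfl⟩ := finProdFinEquiv.surjective w
  refine hw (finProdFinEquiv (v, i + 1)) ⟨?_, Or.inl ?_⟩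
  · rw [Ne, finProdFinEquiv.apply_eq_iff_eq, Prod.mk.injEq]
    rintro ⟨_, h⟩
    revert h
    fin_cases i <;> decide
  · rw [divNat_finProdFinEquiv, divNat_finProdFinEquiv]

theorem le_grundy_doubled_iff (k : ℕ) :
    2 * k ≤ grundyDoubleDominationNumber (doubled G) ↔ k ≤ grundyDominationNumber G :=
  le_grundyDoubleDominationNumber_iff_of_twins (isBlowup_doubled G).mem_closedNbhd
    (s₀ := fun v => finProdFinEquiv (v, 0)) (s₁ := fun v => finProdFinEquiv (v, 1))
    (fun v => divNat_finProdFinEquiv v 0) (fun v => divNat_finProdFinEquiv v 1)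
    (fun v => by simp) (not_isIsolated_doubled G) k

theorem mem_doubled {F : GraphClass} (hF : F.ClosedUnderTrueTwins) (hG : F.Mem (Fin n) G) :
    F.Mem (Fin (n * 2)) (doubled G) :=
  hF.mem_of_isBlowup hG (fun v => ⟨_, divNat_finProdFinEquiv v 0⟩) (isBlowup_doubled G)

theorem nonempty_doubled_iso : Nonempty (doubled G ≃g addTrueTwins G fun _ => 1) := by
  refine ⟨⟨finProdFinEquiv.symm.trans (Equiv.sigmaEquivProd _ _).symm, fun {a b} => ?_⟩⟩
  refine and_congr_left fun _ => ?_
  exact (Equiv.injective (finProdFinEquiv.symm.trans (Equiv.sigmaEquivProd _ _).symm)).ne_iff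

end Doubled

end GrundyDom

/-! ### Counter programs and their compilation to stack machines -/

namespace GrundyDom

open Turing StateTransition

/-- `StepsTo f t a b`: iterating the transition function `f` exactly `t` times leads from `a`
to `b`. -/
def StepsTo {C : Type} (f : C → Option C) (t : ℕ) (a b : C) : Prop :=
  (flip bind f)^[t] (some a) = some b

namespace StepsTo

variable {C : Type} {f : C → Option C} {a b c : C} {s t : ℕ}

theorem refl (a : C) : StepsTo f 0 a a := rfl

theorem trans (h₁ : StepsTo f s a b) (h₂ : StepsTo f t b c) : StepsTo f (s + t) a c := by
  unfold StepsTo at *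
  rw [add_comm, Function.iterate_add_apply, h₁, h₂]

theorem single (h : f a = some b) : StepsTo f 1 a b := h

theorem head (h : f a = some b) (h₂ : StepsTo f t b c) : StepsTo f (1 + t) a c :=
  (single h).trans h₂

theorem succ_iff : StepsTo f (t + 1) a c ↔ ∃ b, f a = some b ∧ StepsTo f t b c := by
  have hnone : ∀ t, (flip bind f)^[t] none = none := by
    intro t
    induction t with
    | zero => rfl
    | succ t ih => exact ih
  unfold StepsTo
  rw [Function.iterate_succ_apply]
  have e : flip bind f (some a) = f a := rfl
  rw [e]
  cases h : f a with
  | none => rw [hnone]; simp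
  | some b => simp

end StepsTo

theorem nonempty_outputsInTime {tm : FinTM2} {x : List (tm.Γ tm.k₀)} {y : List (tm.Γ tm.k₁)}
    {m : ℕ} : Nonempty (TM2OutputsInTime tm x (some y) m) ↔
      ∃ t ≤ m, StepsTo tm.step t (initList tm x) (haltList tm y) :=
  ⟨fun ⟨h⟩ => ⟨h.steps, h.steps_le_m, h.evals_in_steps⟩,
    fun ⟨t, ht, h⟩ => ⟨⟨⟨t, h⟩, ht⟩⟩⟩

/-- A memory state of a counter program: a read-only input word, split at the head position into
the reversed part `pre` to the left of the head and the rest `post`; the output word, whose first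
letter was written last; and counters. -/
structure Mem (A : Type) where
  pre : List A
  post : List A
  out : List Bool
  reg : ℕ → ℕ

/-- The elementary instructions. The head moves are void at the ends of the input word. -/
inductive Op (A : Type)
  /-- Increment a counter. -/
  | inc (r : ℕ)
  /-- Decrement a counter. -/
  | dec (r : ℕ)
  /-- Move the head to the right. -/
  | right
  /-- Move the head to the left. -/
  | left
  /-- Increment a counter if the letter at the head satisfies a condition. -/
  | count (f : Option A → Bool) (r : ℕ)
  /-- Write the bit that tells whether a counter is positive. -/
  | emit (r : ℕ)
  /-- Erase the letter at the head. -/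
  | erase

/-- Loop conditions. -/
inductive Test
  /-- The counter is positive. -/
  | pos (r : ℕ)
  /-- The head has not reached the end of the input word. -/
  | more

/-- Counter programs. -/
inductive Prog (A : Type)
  | op (o : Op A)
  | seq (p q : Prog A)
  | loop (T : Test) (p : Prog A)

section Semantics

variable {A : Type}

/-- The effect of an instruction. -/
def Op.apply : Op A → Mem A → Mem A
  | .inc r, s => { s with reg := Function.update s.reg r (s.reg r + 1) }
  | .dec r, s => { s with reg := Function.update s.reg r (s.reg r - 1) }
  | .right, s =>
    match s.post with
    | [] => s
    | a :: l => { s with pre := a :: s.pre, post := l }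
  | .left, s =>
    match s.pre with
    | [] => s
    | a :: l => { s with pre := l, post := a :: s.post }
  | .count f r, s =>
    { s with reg := Function.update s.reg r (s.reg r + (f s.post.head?).toNat) }
  | .emit r, s => { s with out := decide (s.reg r ≠ 0) :: s.out }
  | .erase, s => { s with post := s.post.tail }

/-- The truth of a loop condition. -/
def Test.Holds : Test → Mem A → Prop
  | .pos r, s => s.reg r ≠ 0
  | .more, s => s.post ≠ []

/-- `Exec p s t s'`: started in `s`, the program `p` stops in `s'` after exactly `t` steps. -/
inductive Exec : Prog A → Mem A → ℕ → Mem A → Prop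
  | op (o s) : Exec (.op o) s 1 (o.apply s)
  | seq {p q s t s' t' s''} : Exec p s t s' → Exec q s' t' s'' → Exec (.seq p q) s (t + t') s''
  | done {T p s} : ¬ T.Holds s → Exec (.loop T p) s 1 s
  | next {T p s t s' t' s''} : T.Holds s → Exec p s t s' → Exec (.loop T p) s' t' s'' →
      Exec (.loop T p) s (1 + t + t') s''

end Semantics

section Compile

variable {A : Type}

/-- The stacks of the machine: the two parts of the input word, the output word, and the
counters `0, …, R` in unary. -/
inductive Stack (R : ℕ)
  | pre
  | post
  | out
  | reg (r : Fin (R + 1))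
  deriving DecidableEq, Fintype

/-- The stack alphabets. -/
abbrev Stack.Alph (A : Type) {R : ℕ} : Stack R → Type
  | .pre => A
  | .post => A
  | .out => Bool
  | .reg _ => Unit

/-- The stack of the counter `r`, which is only meaningful for `r ≤ R`. -/
abbrev Stack.ofReg {R : ℕ} (r : ℕ) : Stack R :=
  .reg ⟨min r R, by omega⟩

/-- The stack contents that represent a memory state. -/
def Mem.stacks (s : Mem A) (R : ℕ) : (k : Stack R) → List (k.Alph A)
  | .pre => s.pre
  | .post => s.post
  | .out => s.out
  | .reg r => List.replicate (s.reg r) ()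

/-- Statements whose internal state is a buffer for one letter. -/
abbrev BufferStmt (A : Type) (R : ℕ) (L : Type) :=
  TM2.Stmt (Stack.Alph A : Stack R → Type) L (Option A)

/-- Empty the buffer and jump. -/
def clearGoto {R : ℕ} {L : Type} (next : L) : BufferStmt A R L :=
  .load (fun _ => none) (.goto fun _ => next)

/-- The statement that performs an instruction and jumps to `next`. -/
def Op.stmt [Inhabited A] {R : ℕ} {L : Type} (next : L) : Op A → BufferStmt A R L
  | .inc r => .push (.ofReg r) (fun _ => ()) (clearGoto next)
  | .dec r => .pop (.ofReg r) (fun s _ => s) (clearGoto next)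
  | .right =>
    .pop .post (fun _ o => o)
      (.branch Option.isSome (.push .pre (fun s => s.getD default) (clearGoto next))
        (clearGoto next))
  | .left =>
    .pop .pre (fun _ o => o)
      (.branch Option.isSome (.push .post (fun s => s.getD default) (clearGoto next))
        (clearGoto next))
  | .count f r =>
    .peek .post (fun _ o => o)
      (.branch f (.push (.ofReg r) (fun _ => ()) (clearGoto next)) (clearGoto next))
  | .emit r =>
    .peek (.ofReg r) (fun _ o => o.map fun _ => default)
      (.push .out (fun s => s.isSome) (clearGoto next))
  | .erase => .pop .post (fun s _ => s) (clearGoto next)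

/-- The statement that evaluates a loop condition and jumps to `a` or to `b`. -/
def Test.stmt [Inhabited A] {R : ℕ} {L : Type} (a b : L) : Test → BufferStmt A R L
  | .pos r =>
    .peek (.ofReg r) (fun _ o => o.map fun _ => default)
      (.branch Option.isSome (clearGoto a) (clearGoto b))
  | .more =>
    .peek .post (fun _ o => o) (.branch Option.isSome (clearGoto a) (clearGoto b))

/-- A bound for the counters that an instruction uses. -/
def Op.maxReg : Op A → ℕ
  | .inc r => r
  | .dec r => r
  | .count _ r => r
  | .emit r => r
  | _ => 0

/-- A bound for the counters that a condition uses. -/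
def Test.maxReg : Test → ℕ
  | .pos r => r
  | .more => 0

/-- A bound for the counters that a program uses. -/
def Prog.maxReg : Prog A → ℕ
  | .op o => o.maxReg
  | .seq p q => max p.maxReg q.maxReg
  | .loop T p => max T.maxReg p.maxReg

theorem update_stacks_reg {R r : ℕ} (hr : r ≤ R) (s : Mem A) (n : ℕ) :
    Function.update (s.stacks R) (.ofReg r) (List.replicate n ()) =
      ({ s with reg := Function.update s.reg r n } : Mem A).stacks R := by
  funext k
  by_cases hk : k = .ofReg r
  · subst hk
    rw [Function.update_self]
    simp [Stack.ofReg, Mem.stacks, hr]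
  · rw [Function.update_of_ne hk]
    cases k with
    | reg i =>
      have : (i : ℕ) ≠ r := by
        rintro rfl
        exact hk (by simp [Stack.ofReg, hr])
      simp [Mem.stacks, Function.update_of_ne this]
    | _ => rfl

theorem stacks_ofReg {R r : ℕ} (hr : r ≤ R) (s : Mem A) :
    s.stacks R (.ofReg r) = List.replicate (s.reg r) () := by
  simp [Stack.ofReg, Mem.stacks, hr]

theorem stacks_post {R : ℕ} (s : Mem A) : s.stacks R .post = s.post := rfl

theorem stacks_pre {R : ℕ} (s : Mem A) : s.stacks R .pre = s.pre := rfl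

theorem update_stacks_post {R : ℕ} (s : Mem A) (l : List A) :
    Function.update (s.stacks R) .post l = ({ s with post := l } : Mem A).stacks R := by
  funext k
  cases k <;> simp [Mem.stacks]

theorem update_stacks_pre {R : ℕ} (s : Mem A) (l : List A) :
    Function.update (s.stacks R) .pre l = ({ s with pre := l } : Mem A).stacks R := by
  funext k
  cases k <;> simp [Mem.stacks]

theorem update_stacks_out {R : ℕ} (s : Mem A) (l : List Bool) :
    Function.update (s.stacks R) .out l = ({ s with out := l } : Mem A).stacks R := by
  funext k
  cases k <;> simp [Mem.stacks]

theorem stepAux_clearGoto {R : ℕ} {L : Type} (next : L) (b : Option A) (S) :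
    TM2.stepAux (clearGoto next : BufferStmt A R L) b S = ⟨some next, none, S⟩ := by
  simp [clearGoto]

theorem head?_replicate_unit (n : ℕ) :
    (List.replicate n ()).head? = if n = 0 then none else some () := by
  cases n <;> simp [List.replicate_succ]

/-- One statement of the machine performs one instruction; the buffer is empty before and after. -/
theorem Op.stepAux_stmt [Inhabited A] {R : ℕ} {L : Type} (next : L) (o : Op A)
    (ho : o.maxReg ≤ R) (s : Mem A) :
    TM2.stepAux (o.stmt next : BufferStmt A R L) none (s.stacks R) =
      ⟨some next, none, (o.apply s).stacks R⟩ := by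
  cases o with
  | inc r =>
    simp only [Op.stmt, TM2.stepAux, stepAux_clearGoto, stacks_ofReg (show r ≤ R from ho)]
    exact congrArg _ (update_stacks_reg ho s (s.reg r + 1))
  | dec r =>
    simp only [Op.stmt, TM2.stepAux, stepAux_clearGoto, stacks_ofReg (show r ≤ R from ho)]
    simp only [List.tail_replicate]
    exact congrArg _ (update_stacks_reg ho s (s.reg r - 1))
  | right =>
    obtain ⟨pre, _ | ⟨a, l⟩, out, reg⟩ := s <;>
      simp [Op.stmt, TM2.stepAux, stepAux_clearGoto, stacks_post, stacks_pre, update_stacks_post,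
        update_stacks_pre, Op.apply]
  | left =>
    obtain ⟨_ | ⟨a, l⟩, post, out, reg⟩ := s <;>
      simp [Op.stmt, TM2.stepAux, stepAux_clearGoto, stacks_post, stacks_pre, update_stacks_post,
        update_stacks_pre, Op.apply]
  | count f r =>
    simp only [Op.stmt, TM2.stepAux, stepAux_clearGoto, stacks_ofReg (show r ≤ R from ho)]
    simp only [stacks_post, Op.apply]
    cases f s.post.head?
    · simp
    · exact congrArg _ (update_stacks_reg ho s (s.reg r + 1))
  | emit r =>
    simp only [Op.stmt, TM2.stepAux, stepAux_clearGoto, stacks_ofReg (show r ≤ R from ho)]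
    refine congrArg _ ((update_stacks_out s _).trans ?_)
    have : (Option.map (fun _ => (default : A)) (List.replicate (s.reg r) ()).head?).isSome
        = decide (s.reg r ≠ 0) := by
      rw [head?_replicate_unit]
      split_ifs with h <;> simp [h]
    simp only [Op.apply]
    rw [← this]
    rfl
  | erase =>
    simp only [Op.stmt, TM2.stepAux, stepAux_clearGoto]
    exact congrArg _ (update_stacks_post _ _)

theorem Test.stepAux_stmt [Inhabited A] {R : ℕ} {L : Type} (a b : L) (T : Test)
    (hT : T.maxReg ≤ R) (s : Mem A) [Decidable (T.Holds s)] :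
    TM2.stepAux (T.stmt a b : BufferStmt A R L) none (s.stacks R) =
      ⟨some (if T.Holds s then a else b), none, s.stacks R⟩ := by
  cases T with
  | pos r =>
    simp only [Test.stmt, TM2.stepAux, stepAux_clearGoto, stacks_ofReg (show r ≤ R from hT)]
    have : (Option.map (fun _ => (default : A)) (List.replicate (s.reg r) ()).head?).isSome
        = decide (s.reg r ≠ 0) := by
      rw [head?_replicate_unit]
      split_ifs with h <;> simp [h]
    refine (congrArg (fun c => cond c _ _) this).trans ?_
    by_cases h : s.reg r = 0 <;> simp [h, Test.Holds]
  | more =>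
    simp only [Test.stmt, TM2.stepAux, stepAux_clearGoto, stacks_post]
    cases hs : s.post <;> simp [hs, Test.Holds]

/-- The labels of the code of a program. -/
def Prog.Lab : Prog A → Type
  | .op _ => Unit
  | .seq p q => p.Lab ⊕ q.Lab
  | .loop _ p => Option p.Lab

instance Prog.fintypeLab : (p : Prog A) → Fintype p.Lab
  | .op _ => inferInstanceAs (Fintype Unit)
  | .seq p q =>
    have := fintypeLab p
    have := fintypeLab q
    inferInstanceAs (Fintype (p.Lab ⊕ q.Lab))
  | .loop _ p =>
    have := fintypeLab p
    inferInstanceAs (Fintype (Option p.Lab))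

/-- The label at which the code of a program is entered. -/
def Prog.entry : (p : Prog A) → p.Lab
  | .op _ => ()
  | .seq p _ => Sum.inl p.entry
  | .loop _ _ => none

/-- The code of a program, placed by `emb` into a larger label set and left through `exit`. -/
def Prog.code [Inhabited A] {R : ℕ} {L : Type} :
    (p : Prog A) → (p.Lab → L) → L → p.Lab → BufferStmt A R L
  | .op o, _, exit, _ => o.stmt exit
  | .seq p q, emb, exit, l =>
    match l with
    | Sum.inl l => p.code (fun l => emb (Sum.inl l)) (emb (Sum.inr q.entry)) l
    | Sum.inr l => q.code (fun l => emb (Sum.inr l)) exit l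
  | .loop T p, emb, exit, l =>
    match l with
    | none => T.stmt (emb (some p.entry)) exit
    | some l => p.code (fun l => emb (some l)) (emb none) l

/-- The code of a program simulates it step by step, wherever it is placed. -/
theorem Exec.stepsTo [Inhabited A] {R : ℕ} {L : Type} {p : Prog A} {s s' : Mem A} {t : ℕ}
    (h : Exec p s t s') (hp : p.maxReg ≤ R) (M : L → BufferStmt A R L) (emb : p.Lab → L)
    (exit : L) (hM : ∀ l, M (emb l) = p.code emb exit l) :
    StepsTo (TM2.step M) t ⟨some (emb p.entry), none, s.stacks R⟩
      ⟨some exit, none, s'.stacks R⟩ := by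
  induction h generalizing exit with
  | op o s =>
    refine StepsTo.single ?_
    rw [TM2.step, hM]
    exact congrArg some (o.stepAux_stmt exit hp s)
  | @seq p q s t s' t' s'' _ _ ih₁ ih₂ =>
    have hp' : max p.maxReg q.maxReg ≤ R := hp
    exact (ih₁ (le_trans (le_max_left _ _) hp') (fun l => emb (Sum.inl l)) _
      (fun l => hM (Sum.inl l))).trans
      (ih₂ (le_trans (le_max_right _ _) hp') (fun l => emb (Sum.inr l)) _
        (fun l => hM (Sum.inr l)))
  | @done T p s hT =>
    classical
    have hp' : max T.maxReg p.maxReg ≤ R := hp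
    refine StepsTo.single ?_
    rw [TM2.step, hM]
    refine congrArg some ((T.stepAux_stmt _ _ (le_trans (le_max_left _ _) hp') s).trans ?_)
    rw [if_neg hT]
  | @next T p s t s' t' s'' hT _ _ ih₁ ih₂ =>
    classical
    have hp' : max T.maxReg p.maxReg ≤ R := hp
    rw [add_assoc]
    refine StepsTo.head ?_ ((ih₁ (le_trans (le_max_right _ _) hp') (fun l => emb (some l)) _
      (fun l => hM (some l))).trans (ih₂ hp emb exit hM))
    rw [TM2.step, hM]
    refine congrArg some ((T.stepAux_stmt _ _ (le_trans (le_max_left _ _) hp') s).trans ?_)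
    rw [if_pos hT]

/-- The stack machine of a program, with the additional label `none` for halting. -/
def Prog.machine [Inhabited A] [Fintype A] (p : Prog A) : FinTM2 where
  K := Stack p.maxReg
  k₀ := .post
  k₁ := .out
  Γ := Stack.Alph A
  Λ := Option p.Lab
  main := some p.entry
  σ := Option A
  initialState := none
  Γk₀Fin := inferInstanceAs (Fintype A)
  m
    | none => .halt
    | some l => p.code some none l

/-- A program that leaves the input word and all counters empty gives a machine in the sense of
`FinTM2`, which has to halt with all stacks but the output empty. -/
theorem Exec.outputs [Inhabited A] [Fintype A] {p : Prog A} {x : List A} {y : List Bool} {t : ℕ}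
    (h : Exec p ⟨[], x, [], fun _ => 0⟩ t ⟨[], [], y, fun _ => 0⟩) :
    StepsTo p.machine.step (t + 1) (initList p.machine x) (haltList p.machine y) := by
  have h₁ := h.stepsTo le_rfl p.machine.m some none (fun _ => rfl)
  have e₁ : initList p.machine x =
      ⟨some (some p.entry), none, (⟨[], x, [], fun _ => 0⟩ : Mem A).stacks p.maxReg⟩ := by
    refine congrArg (TM2.Cfg.mk _ _) (funext fun k => ?_)
    cases k <;> rfl
  have e₂ : haltList p.machine y =
      ⟨none, none, (⟨[], [], y, fun _ => 0⟩ : Mem A).stacks p.maxReg⟩ := by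
    refine congrArg (TM2.Cfg.mk _ _) (funext fun k => ?_)
    cases k <;> rfl
  rw [e₁, e₂]
  exact h₁.trans (StepsTo.single rfl)

end Compile

end GrundyDom

/-! ### Arithmetic expressions over words -/

namespace GrundyDom

open Turing StateTransition Function

/-- `Polynomial.eval` is monotone over `ℕ`. -/
theorem polynomial_eval_mono (p : Polynomial ℕ) {m n : ℕ} (h : m ≤ n) : p.eval m ≤ p.eval n := by
  rw [Polynomial.eval_eq_sum_range, Polynomial.eval_eq_sum_range]
  gcongr

section Loops

variable {A : Type}

/-- `ExecIn p s B s'`: started in `s`, the program `p` stops in `s'` after at most `B` steps. -/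
def ExecIn (p : Prog A) (s : Mem A) (B : ℕ) (s' : Mem A) : Prop :=
  ∃ t ≤ B, Exec p s t s'

namespace ExecIn

variable {p q : Prog A} {s s' s'' : Mem A} {B B' : ℕ}

theorem mono (h : ExecIn p s B s') (hB : B ≤ B') : ExecIn p s B' s' := by
  obtain ⟨t, ht, h⟩ := h
  exact ⟨t, ht.trans hB, h⟩

theorem op {o : Op A} (h : o.apply s = s') : ExecIn (.op o) s 1 s' :=
  ⟨1, le_rfl, h ▸ .op o s⟩

theorem seq (h : ExecIn p s B s') (h' : ExecIn q s' B' s'') :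
    ExecIn (.seq p q) s (B + B') s'' := by
  obtain ⟨t, ht, h⟩ := h
  obtain ⟨t', ht', h'⟩ := h'
  exact ⟨t + t', by omega, h.seq h'⟩

/-- A loop that passes through the states `S n, S (n - 1), …, S 0`. -/
theorem loop {T : Test} (S : ℕ → Mem A) (h₀ : ¬ T.Holds (S 0)) (n : ℕ)
    (h : ∀ i < n, T.Holds (S (i + 1)) ∧ ExecIn p (S (i + 1)) B (S i)) :
    ExecIn (.loop T p) (S n) (n * (B + 1) + 1) (S 0) := by
  induction n with
  | zero => exact ⟨1, by omega, .done h₀⟩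
  | succ n ih =>
    obtain ⟨t', ht', h'⟩ := ih fun i hi => h i (by omega)
    obtain ⟨hT, t, ht, h''⟩ := h n (by omega)
    exact ⟨1 + t + t', by linarith, .next hT h'' h'⟩

end ExecIn

/-- Empty the counter `r`. -/
def clearReg (r : ℕ) : Prog A := .loop (.pos r) (.op (.dec r))

/-- Move the contents of the counter `r` to the counter `d`. -/
def moveReg (r d : ℕ) : Prog A := .loop (.pos r) (.seq (.op (.dec r)) (.op (.inc d)))

/-- Empty the counter `r` and subtract its contents from the counter `d`. -/
def subReg (r d : ℕ) : Prog A := .loop (.pos r) (.seq (.op (.dec r)) (.op (.dec d)))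

variable {pre post : List A} {o : List Bool}

theorem execIn_clearReg (r : ℕ) (g : ℕ → ℕ) :
    ExecIn (clearReg r) ⟨pre, post, o, g⟩ (g r * 2 + 1) ⟨pre, post, o, update g r 0⟩ := by
  have := ExecIn.loop (T := .pos r) (p := .op (.dec r)) (B := 1)
    (fun i => ⟨pre, post, o, update g r i⟩) (by simp [Test.Holds]) (g r)
    (fun i _ => ⟨by simp [Test.Holds], .op (by simp [Op.apply])⟩)
  simpa [clearReg] using this

theorem execIn_moveReg {r d : ℕ} (hrd : r ≠ d) (g : ℕ → ℕ) :
    ExecIn (moveReg r d) ⟨pre, post, o, g⟩ (g r * 3 + 1)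
      ⟨pre, post, o, update (update g r 0) d (g d + g r)⟩ := by
  have := ExecIn.loop (T := .pos r) (p := .seq (.op (.dec r)) (.op (.inc d))) (B := 1 + 1)
    (fun i => ⟨pre, post, o, update (update g r i) d (g d + (g r - i))⟩)
    (by simp [Test.Holds, hrd]) (g r)
    (fun i hi => ⟨by simp [Test.Holds, hrd], .seq (.op rfl) (.op ?_)⟩)
  · simpa [moveReg] using this
  · simp only [Op.apply, Mem.mk.injEq, true_and]
    funext k
    simp only [update_apply]
    split_ifs <;> omega

theorem execIn_subReg {r d : ℕ} (hrd : r ≠ d) (g : ℕ → ℕ) :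
    ExecIn (subReg r d) ⟨pre, post, o, g⟩ (g r * 3 + 1)
      ⟨pre, post, o, update (update g r 0) d (g d - g r)⟩ := by
  have := ExecIn.loop (T := .pos r) (p := .seq (.op (.dec r)) (.op (.dec d))) (B := 1 + 1)
    (fun i => ⟨pre, post, o, update (update g r i) d (g d - (g r - i))⟩)
    (by simp [Test.Holds, hrd]) (g r)
    (fun i hi => ⟨by simp [Test.Holds, hrd], .seq (.op rfl) (.op ?_)⟩)
  · simpa [subReg] using this
  · simp only [Op.apply, Mem.mk.injEq, true_and]
    funext k
    simp only [update_apply]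
    split_ifs <;> omega

end Loops

/-- Arithmetic expressions that read a word over `A`. Variables are named by natural numbers.
Products of variables are sums, so that all values are polynomially bounded. -/
inductive Expr (A : Type)
  | var (x : ℕ)
  | one
  | add (a b : Expr A)
  /-- Truncated subtraction. -/
  | sub (a b : Expr A)
  /-- `1` or `0`, depending on a condition on the letter at position `e`. -/
  | sym (f : Option A → Bool) (e : Expr A)
  /-- The sum of `b` over all `x < n`. -/
  | sum (x : ℕ) (n b : Expr A)
  /-- Recursion: `y` starts with `0` and becomes `c - b` for each `x < n`, in decreasing order.
  The truncated subtraction from `c` keeps the values bounded. -/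
  | fold (x y : ℕ) (n c b : Expr A)

/-- The value after the steps `F (n - 1)`, …, `F 0`, started with `a`. -/
def descend (F : ℕ → ℕ → ℕ) : ℕ → ℕ → ℕ
  | 0, a => a
  | n + 1, a => descend F n (F n a)

namespace Expr

variable {A : Type}

/-- The value of an expression on the word `w`. -/
def eval (w : List A) : Expr A → (ℕ → ℕ) → ℕ
  | var x, ρ => ρ x
  | one, _ => 1
  | add a b, ρ => a.eval w ρ + b.eval w ρ
  | sub a b, ρ => a.eval w ρ - b.eval w ρ
  | sym f e, ρ => (f w[e.eval w ρ]?).toNat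
  | sum x n b, ρ => ∑ i ∈ Finset.range (n.eval w ρ), b.eval w (update ρ x i)
  | fold x y n c b, ρ =>
    descend (fun i a => c.eval w ρ - b.eval w (update (update ρ x i) y a)) (n.eval w ρ) 0

/-- The program that adds the value of an expression to the counter `d`. The counter `env x` holds
the variable `x`, and the counters from `f` on are free and empty. -/
def compile : Expr A → (ℕ → ℕ) → ℕ → ℕ → Prog A
  | var x, env, d, f =>
    .seq (.loop (.pos (env x))
      (.seq (.op (.dec (env x))) (.seq (.op (.inc f)) (.op (.inc d))))) (moveReg f (env x))
  | one, _, d, _ => .op (.inc d)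
  | add a b, env, d, f => .seq (a.compile env d f) (b.compile env d f)
  | sub a b, env, d, f =>
    .seq (a.compile env f (f + 2)) (.seq (b.compile env (f + 1) (f + 2))
      (.seq (subReg (f + 1) f) (moveReg f d)))
  | sym g e, env, d, f =>
    .seq (e.compile env f (f + 2)) (.seq
      (.loop (.pos f) (.seq (.op (.dec f)) (.seq (.op (.inc (f + 1))) (.op .right))))
      (.seq (.op (.count g d)) (.loop (.pos (f + 1)) (.seq (.op (.dec (f + 1))) (.op .left)))))
  | sum x n b, env, d, f =>
    .seq (n.compile env f (f + 1))
      (.loop (.pos f) (.seq (.op (.dec f)) (b.compile (update env x f) d (f + 1))))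
  | fold x y n c b, env, d, f =>
    .seq (n.compile env f (f + 3)) (.seq
      (.loop (.pos f) (.seq (.op (.dec f)) (.seq
        (b.compile (update (update env x f) y (f + 1)) (f + 2) (f + 3)) (.seq
          (clearReg (f + 1)) (.seq (c.compile env (f + 1) (f + 3)) (subReg (f + 2) (f + 1)))))))
      (moveReg (f + 1) d))

theorem descend_le {F : ℕ → ℕ → ℕ} {c : ℕ} (h : ∀ i a, F i a ≤ c) :
    ∀ n a, a ≤ c → descend F n a ≤ c
  | 0, _, ha => ha
  | n + 1, a, _ => descend_le h n _ (h n a)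

/-- The value of an expression is polynomially bounded in the values of its variables. -/
theorem exists_eval_le (e : Expr A) :
    ∃ V : Polynomial ℕ, ∀ (w : List A) (ρ : ℕ → ℕ) (N : ℕ), (∀ x, ρ x ≤ N) →
      e.eval w ρ ≤ V.eval N := by
  induction e with
  | var x => exact ⟨.X, fun w ρ N h => by simpa [eval] using h x⟩
  | one => exact ⟨1, fun w ρ N h => by simp [eval]⟩
  | add a b iha ihb =>
    obtain ⟨Va, ha⟩ := iha
    obtain ⟨Vb, hb⟩ := ihb
    refine ⟨Va + Vb, fun w ρ N h => ?_⟩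
    rw [Polynomial.eval_add]
    exact add_le_add (ha w ρ N h) (hb w ρ N h)
  | sub a b iha ihb =>
    obtain ⟨Va, ha⟩ := iha
    exact ⟨Va, fun w ρ N h => (Nat.sub_le _ _).trans (ha w ρ N h)⟩
  | sym f e ih => exact ⟨1, fun w ρ N h => by simpa [eval] using Bool.toNat_le _⟩
  | sum x n b ihn ihb =>
    obtain ⟨Vn, hn⟩ := ihn
    obtain ⟨Vb, hb⟩ := ihb
    refine ⟨Vn * Vb.comp (.X + Vn), fun w ρ N h => ?_⟩
    have h₁ := hn w ρ N h
    rw [eval, Polynomial.eval_mul, Polynomial.eval_comp, Polynomial.eval_add, Polynomial.eval_X]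
    refine (Finset.sum_le_card_nsmul _ _ (Vb.eval (N + Vn.eval N)) fun i hi => ?_).trans ?_
    · refine hb w _ _ fun y => ?_
      have := h y
      have := Finset.mem_range.1 hi
      rw [update_apply]
      split_ifs <;> omega
    · rw [Finset.card_range, smul_eq_mul]
      gcongr
  | fold x y n c b ihn ihc ihb =>
    obtain ⟨Vc, hc⟩ := ihc
    exact ⟨Vc, fun w ρ N h =>
      (descend_le (fun i a => Nat.sub_le _ _) _ _ (Nat.zero_le _)).trans (hc w ρ N h)⟩

/-- The counters `env y` below `f` hold the values `ρ y`, the counter `d` is a different one, and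
the counters from `f` on are empty. -/
structure Fits (ρ env : ℕ → ℕ) (d f : ℕ) (g : ℕ → ℕ) : Prop where
  env_lt : ∀ y, env y < f
  dest_lt : d < f
  env_ne : ∀ y, env y ≠ d
  value : ∀ y, g (env y) = ρ y
  free : ∀ r, f ≤ r → g r = 0

theorem _root_.GrundyDom.ExecIn.congr {p : Prog A} {w : List A} {o : List Bool}
    {g g' g₁' : ℕ → ℕ} {B B' : ℕ} (h : ExecIn p ⟨[], w, o, g⟩ B ⟨[], w, o, g'⟩)
    (hg' : g' = g₁') (hB : B ≤ B') : ExecIn p ⟨[], w, o, g⟩ B' ⟨[], w, o, g₁'⟩ := by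
  subst hg'
  exact h.mono hB

/-- Copying the counter `i` to the counter `d`, with the help of the empty counter `f`. -/
theorem execIn_compile_var (w : List A) (o : List Bool) {i d f : ℕ} (g : ℕ → ℕ) (hi : i < f)
    (hd : d < f) (hid : i ≠ d) (hg : g f = 0) :
    ExecIn (.seq (.loop (.pos i) (.seq (.op (.dec i)) (.seq (.op (.inc f)) (.op (.inc d)))))
      (moveReg f i) : Prog A) ⟨[], w, o, g⟩ (g i * 7 + 2) ⟨[], w, o, update g d (g d + g i)⟩ := by
  have h₁ := ExecIn.loop (A := A) (T := .pos i)
    (p := .seq (.op (.dec i)) (.seq (.op (.inc f)) (.op (.inc d)))) (B := 1 + (1 + 1))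
    (fun j => ⟨[], w, o, update (update (update g i j) f (g i - j)) d (g d + (g i - j))⟩)
    (by simp [Test.Holds, hid, hi.ne]) (g i)
    (fun j hj => ⟨by simp [Test.Holds, hid, hi.ne], .seq (.op rfl) (.seq (.op rfl) (.op ?_))⟩)
  · have h₂ := execIn_moveReg (pre := []) (post := w) (o := o) hi.ne'
      (update (update (update g i 0) f (g i - 0)) d (g d + (g i - 0)))
    have e : g = update (update (update g i (g i)) f (g i - g i)) d (g d + (g i - g i)) := by
      funext k
      grind [update_apply]
    rw [← e] at h₁
    refine (h₁.seq h₂).congr ?_ ?_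
    · funext k
      grind [update_apply]
    · grind [update_apply]
  · simp only [Op.apply, Mem.mk.injEq, true_and]
    funext k
    grind [update_apply]

theorem right_apply (w : List A) (o : List Bool) (g : ℕ → ℕ) (j : ℕ) :
    Op.right.apply ⟨(w.take j).reverse, w.drop j, o, g⟩ =
      ⟨(w.take (j + 1)).reverse, w.drop (j + 1), o, g⟩ := by
  by_cases hj : j < w.length
  · rw [List.drop_eq_getElem_cons hj, List.take_succ_eq_append_getElem hj, List.reverse_append]
    rfl
  · have h : w.drop j = [] := List.drop_eq_nil_of_le (by omega)
    rw [h, List.drop_eq_nil_of_le (by omega), List.take_of_length_le (by omega),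
      List.take_of_length_le (by omega)]
    rfl

theorem left_apply (w : List A) (o : List Bool) (g : ℕ → ℕ) {j : ℕ} (hj : j ≤ w.length) :
    Op.left.apply ⟨(w.take j).reverse, w.drop j, o, g⟩ =
      ⟨(w.take (j - 1)).reverse, w.drop (j - 1), o, g⟩ := by
  cases j with
  | zero => rfl
  | succ j =>
    rw [Nat.add_sub_cancel, List.take_succ_eq_append_getElem (by omega),
      List.drop_eq_getElem_cons (show j < w.length by omega), List.reverse_append]
    rfl

/-- Reading the letter at the position given by the counter `f`: the head moves there, the
condition is evaluated, and the head moves back. -/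
theorem execIn_compile_sym (w : List A) (o : List Bool) (c : Option A → Bool) {d f : ℕ}
    (g : ℕ → ℕ) (hd : d < f) (hg : g (f + 1) = 0) :
    ExecIn (.seq
      (.loop (.pos f) (.seq (.op (.dec f)) (.seq (.op (.inc (f + 1))) (.op .right))))
      (.seq (.op (.count c d)) (.loop (.pos (f + 1)) (.seq (.op (.dec (f + 1))) (.op .left)))))
      ⟨[], w, o, g⟩ (g f * 7 + 3)
      ⟨[], w, o, update (update g f 0) d (g d + (c w[g f]?).toNat)⟩ := by
  have h₁ := ExecIn.loop (A := A) (T := .pos f)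
    (p := .seq (.op (.dec f)) (.seq (.op (.inc (f + 1))) (.op .right))) (B := 1 + (1 + 1))
    (fun j => ⟨(w.take (g f - j)).reverse, w.drop (g f - j), o,
      update (update g f j) (f + 1) (g f - j)⟩)
    (by simp [Test.Holds]) (g f)
    (fun j hj => ⟨by simp [Test.Holds], .seq (.op rfl) (.seq (.op rfl) (.op ?_))⟩)
  · have h₂ : ExecIn (.op (.count c d)) ⟨(w.take (g f - 0)).reverse, w.drop (g f - 0), o,
        update (update g f 0) (f + 1) (g f - 0)⟩ 1 ⟨(w.take (g f)).reverse, w.drop (g f), o,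
        update (update (update g f 0) (f + 1) (g f)) d (g d + (c w[g f]?).toNat)⟩ := by
      refine .op ?_
      simp only [Op.apply, Mem.mk.injEq, Nat.sub_zero, true_and, List.head?_drop]
      funext k
      grind [update_apply]
    have h₃ := ExecIn.loop (A := A) (T := .pos (f + 1))
      (p := .seq (.op (.dec (f + 1))) (.op .left)) (B := 1 + 1)
      (fun j => ⟨(w.take (min (g f) w.length - (g f - j))).reverse,
        w.drop (min (g f) w.length - (g f - j)), o,
        update (update (update g f 0) (f + 1) j) d (g d + (c w[g f]?).toNat)⟩)
      (by simp [Test.Holds, (show f + 1 ≠ d by omega)]) (g f)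
      (fun j hj => ⟨by simp [Test.Holds, (show f + 1 ≠ d by omega)],
        .seq (.op rfl) (.op ?_)⟩)
    · have e₁ : w.take (min (g f) w.length - (g f - g f)) = w.take (g f) := by
        rcases le_total (g f) w.length with h | h
        · simp [h]
        · simp [h]
      have e₂ : w.drop (min (g f) w.length - (g f - g f)) = w.drop (g f) := by
        rcases le_total (g f) w.length with h | h
        · simp [h]
        · simp [h]
      have e₃ : min (g f) w.length - (g f - 0) = 0 := by omega
      rw [e₁, e₂, e₃] at h₃
      have e₄ : update (update g f (g f)) (f + 1) (g f - g f) = g := by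
        funext k
        grind [update_apply]
      rw [e₄] at h₁
      simp only [Nat.sub_self, List.take_zero, List.drop_zero, List.reverse_nil] at h₁ h₃
      refine (h₁.seq (h₂.seq h₃)).congr ?_ (by omega)
      funext k
      grind [update_apply]
    · have e : min (g f) w.length - (g f - j) = min (g f) w.length - (g f - (j + 1)) - 1 := by
        omega
      refine (left_apply _ _ _ (by omega)).trans ?_
      rw [← e]
      simp only [Mem.mk.injEq, true_and]
      funext k
      grind [update_apply]
  · refine (right_apply _ _ _ _).trans ?_
    rw [(show g f - (j + 1) + 1 = g f - j by omega)]
    simp only [Op.apply, Mem.mk.injEq, true_and]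
    funext k
    grind [update_apply]

/-- Running time and effect of the code of an expression. -/
theorem exists_execIn_compile (e : Expr A) :
    ∃ T : Polynomial ℕ, ∀ (w : List A) (o : List Bool) (ρ env : ℕ → ℕ) (d f : ℕ) (g : ℕ → ℕ)
      (N : ℕ), (∀ y, ρ y ≤ N) → Fits ρ env d f g →
      ExecIn (e.compile env d f) ⟨[], w, o, g⟩ (T.eval N)
        ⟨[], w, o, update g d (g d + e.eval w ρ)⟩ := by
  induction e with
  | var x =>
    refine ⟨7 * .X + 2, fun w o ρ env d f g N hN hf => ?_⟩
    refine (execIn_compile_var w o g (hf.env_lt x) hf.dest_lt (hf.env_ne x)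
      (hf.free f le_rfl)).congr ?_ ?_
    · rw [hf.value, eval]
    · have := hN x
      rw [hf.value]
      simp only [Polynomial.eval_add, Polynomial.eval_mul, Polynomial.eval_X,
        Polynomial.eval_ofNat]
      omega
  | one => exact ⟨1, fun w o ρ env d f g N hN hf => by simpa using .op rfl⟩
  | add a b iha ihb =>
    obtain ⟨Ta, ha⟩ := iha
    obtain ⟨Tb, hb⟩ := ihb
    refine ⟨Ta + Tb, fun w o ρ env d f g N hN hf => ?_⟩
    have hf' : Fits ρ env d f (update g d (g d + a.eval w ρ)) := by
      obtain ⟨h₁, h₂, h₃, h₄, h₅⟩ := hf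
      constructor <;> grind [update_apply]
    refine ((ha w o ρ env d f g N hN hf).seq (hb w o ρ env d f _ N hN hf')).congr ?_ ?_
    · funext k
      grind [update_apply, eval]
    · rw [Polynomial.eval_add]
  | sub a b iha ihb =>
    obtain ⟨Ta, ha⟩ := iha
    obtain ⟨Tb, hb⟩ := ihb
    obtain ⟨Va, hVa⟩ := exists_eval_le a
    obtain ⟨Vb, hVb⟩ := exists_eval_le b
    refine ⟨Ta + (Tb + ((Vb * 3 + 1) + (Va * 3 + 1))), fun w o ρ env d f g N hN hf => ?_⟩
    have ha' := hVa w ρ N hN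
    have hb' := hVb w ρ N hN
    obtain ⟨h₁, h₂, h₃, h₄, h₅⟩ := hf
    have hf₁ : Fits ρ env f (f + 2) g := by constructor <;> grind
    have hf₂ : Fits ρ env (f + 1) (f + 2) (update g f (g f + a.eval w ρ)) := by
      constructor <;> grind [update_apply]
    refine ((ha w o ρ env _ _ g N hN hf₁).seq ((hb w o ρ env _ _ _ N hN hf₂).seq
      ((execIn_subReg (by omega) _).seq (execIn_moveReg (by omega) _)))).congr ?_ ?_
    · funext k
      grind [update_apply, eval]
    · simp only [Polynomial.eval_add, Polynomial.eval_mul, Polynomial.eval_one,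
        Polynomial.eval_ofNat]
      grind [update_apply]
  | sym c e ih =>
    obtain ⟨T, h⟩ := ih
    obtain ⟨V, hV⟩ := exists_eval_le e
    refine ⟨T + (V * 7 + 3), fun w o ρ env d f g N hN hf => ?_⟩
    have hV' := hV w ρ N hN
    obtain ⟨h₁, h₂, h₃, h₄, h₅⟩ := hf
    have hf₁ : Fits ρ env f (f + 2) g := by constructor <;> grind
    have hz : g f + e.eval w ρ = e.eval w ρ := by grind
    refine ((h w o ρ env _ _ g N hN hf₁).seq
      (execIn_compile_sym w o c _ h₂ (by grind [update_apply]))).congr ?_ ?_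
    · funext k
      simp only [update_self, hz]
      grind [update_apply, eval]
    · simp only [Polynomial.eval_add, Polynomial.eval_mul, Polynomial.eval_ofNat, update_self, hz]
      omega
  | sum x n b ihn ihb =>
    obtain ⟨Tn, hn⟩ := ihn
    obtain ⟨Tb, hb⟩ := ihb
    obtain ⟨Vn, hVn⟩ := exists_eval_le n
    refine ⟨Tn + (Vn * (1 + Tb.comp (.X + Vn) + 1) + 1), fun w o ρ env d f g N hN hf => ?_⟩
    have hn' := hVn w ρ N hN
    obtain ⟨h₁, h₂, h₃, h₄, h₅⟩ := hf
    have hf₁ : Fits ρ env f (f + 1) g := by constructor <;> grind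
    set v := n.eval w ρ with hv
    have hloop := ExecIn.loop (A := A) (T := .pos f)
      (p := .seq (.op (.dec f)) (b.compile (update env x f) d (f + 1)))
      (B := 1 + Tb.eval (N + Vn.eval N))
      (fun j => ⟨[], w, o, update (update g f j) d
        (g d + ∑ i ∈ Finset.Ico j v, b.eval w (update ρ x i))⟩)
      (by simp [Test.Holds, h₂.ne']) v (fun j hj => ⟨by simp [Test.Holds, h₂.ne'], ?_⟩)
    · refine ((hn w o ρ env _ _ g N hN hf₁).seq ?_).congr (B := Tn.eval N + (v * (1 +
        Tb.eval (N + Vn.eval N) + 1) + 1)) (g' := update (update g f 0) d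
        (g d + ∑ i ∈ Finset.Ico 0 v, b.eval w (update ρ x i))) ?_ ?_
      · refine (congrArg (fun r => ExecIn _ (⟨[], w, o, r⟩ : Mem A) _ _) ?_).mpr hloop
        rw [Finset.Ico_self, Finset.sum_empty, add_zero, h₅ f le_rfl, zero_add]
        funext k
        grind [update_apply]
      · funext k
        rw [eval, ← hv, Finset.range_eq_Ico]
        grind [update_apply]
      · simp only [Polynomial.eval_add, Polynomial.eval_mul, Polynomial.eval_one,
          Polynomial.eval_comp, Polynomial.eval_X]
        gcongr
    · have hf₂ : Fits (update ρ x j) (update env x f) d (f + 1) (update (update g f j) d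
          (g d + ∑ i ∈ Finset.Ico (j + 1) v, b.eval w (update ρ x i))) := by
        constructor <;> grind [update_apply]
      have hb' := hb w o (update ρ x j) _ d (f + 1) _ (N + Vn.eval N)
        (by grind [update_apply]) hf₂
      refine .seq (.op ?_) (hb'.congr ?_ le_rfl)
      · simp only [Op.apply, Mem.mk.injEq, true_and]
        funext k
        grind [update_apply]
      · have := Finset.sum_eq_sum_Ico_succ_bot hj fun i => b.eval w (update ρ x i)
        funext k
        grind [update_apply]
  | fold x y n c b ihn ihc ihb =>
    obtain ⟨Tn, hn⟩ := ihn
    obtain ⟨Tc, hc⟩ := ihc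
    obtain ⟨Tb, hb⟩ := ihb
    obtain ⟨Vn, hVn⟩ := exists_eval_le n
    obtain ⟨Vc, hVc⟩ := exists_eval_le c
    obtain ⟨Vb, hVb⟩ := exists_eval_le b
    refine ⟨Tn + ((Vn * ((1 + (Tb.comp (.X + Vn + Vc) + ((Vc * 2 + 1) +
      (Tc + (Vb.comp (.X + Vn + Vc) * 3 + 1))))) + 1) + 1) + (Vc * 3 + 1)),
      fun w o ρ env d f g N hN hf => ?_⟩
    have hn' := hVn w ρ N hN
    have hc' := hVc w ρ N hN
    obtain ⟨h₁, h₂, h₃, h₄, h₅⟩ := hf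
    have hf₁ : Fits ρ env f (f + 3) g := by constructor <;> grind
    set v := n.eval w ρ with hv
    set F : ℕ → ℕ → ℕ := fun i a => c.eval w ρ - b.eval w (update (update ρ x i) y a) with hF
    -- `acc j` is the value of `y` after the steps `F (v - 1)`, …, `F j`
    obtain ⟨acc, hacc₀, hacc, hacc_le, hacc_end⟩ : ∃ acc : ℕ → ℕ, acc v = 0 ∧
        (∀ j < v, acc j = F j (acc (j + 1))) ∧ (∀ j ≤ v, acc j ≤ c.eval w ρ) ∧
        acc 0 = descend F v 0 := by
      have key : ∀ v a, a ≤ c.eval w ρ → ∃ acc : ℕ → ℕ, acc v = a ∧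
          (∀ j < v, acc j = F j (acc (j + 1))) ∧ (∀ j ≤ v, acc j ≤ c.eval w ρ) ∧
          acc 0 = descend F v a := by
        intro v
        induction v with
        | zero =>
          exact fun a ha => ⟨fun _ => a, rfl, fun j hj => by omega, fun _ _ => ha, rfl⟩
        | succ v ih =>
          intro a ha
          obtain ⟨acc, e₁, e₂, e₃, e₄⟩ := ih (F v a) (Nat.sub_le _ _)
          refine ⟨update acc (v + 1) a, by simp, fun j hj => ?_, fun j hj => ?_, ?_⟩
          · grind [update_apply]
          · grind [update_apply]
          · rw [update_of_ne (by omega), e₄, descend]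
      exact key v 0 (Nat.zero_le _)
    have hloop := ExecIn.loop (A := A) (T := .pos f)
      (p := .seq (.op (.dec f)) (.seq
        (b.compile (update (update env x f) y (f + 1)) (f + 2) (f + 3)) (.seq
          (clearReg (f + 1)) (.seq (c.compile env (f + 1) (f + 3)) (subReg (f + 2) (f + 1))))))
      (B := 1 + (Tb.eval (N + Vn.eval N + Vc.eval N) + ((Vc.eval N * 2 + 1) +
        (Tc.eval N + (Vb.eval (N + Vn.eval N + Vc.eval N) * 3 + 1)))))
      (fun j => ⟨[], w, o, update (update g f j) (f + 1) (acc j)⟩)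
      (by simp [Test.Holds]) v (fun j hj => ⟨by simp [Test.Holds], ?_⟩)
    · have e₁ : update (update g f v) (f + 1) (acc v) = update g f (g f + v) := by
        rw [hacc₀, h₅ f le_rfl, zero_add]
        funext k
        grind [update_apply]
      rw [e₁] at hloop
      have hmove := execIn_moveReg (pre := []) (post := w) (o := o) (r := f + 1) (d := d)
        (by omega) (update (update g f 0) (f + 1) (acc 0))
      refine ((hn w o ρ env _ _ g N hN hf₁).seq (hloop.seq hmove)).congr ?_ ?_
      · rw [update_self, eval, ← hv, ← hF, ← hacc_end]
        funext k
        grind [update_apply]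
      · have := hacc_le 0 (Nat.zero_le _)
        simp only [Polynomial.eval_add, Polynomial.eval_mul, Polynomial.eval_one,
          Polynomial.eval_comp, Polynomial.eval_X, Polynomial.eval_ofNat, update_self]
        gcongr
        exact this.trans hc'
    · have hρ : ∀ z, update (update ρ x j) y (acc (j + 1)) z ≤ N + Vn.eval N + Vc.eval N := by
        have := hacc_le (j + 1) hj
        grind [update_apply]
      have hf₂ : Fits (update (update ρ x j) y (acc (j + 1)))
          (update (update env x f) y (f + 1)) (f + 2) (f + 3)
          (update (update g f j) (f + 1) (acc (j + 1))) := by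
        constructor <;> grind [update_apply]
      have hb' := hb w o _ _ _ _ _ _ hρ hf₂
      have hVb' := hVb w _ _ hρ
      have hj' := hacc_le (j + 1) hj
      have ej := hacc j hj
      set B := b.eval w (update (update ρ x j) y (acc (j + 1))) with hB
      have e₁ : update (update g f j) (f + 1) (acc (j + 1)) (f + 2) + B = B := by
        grind [update_apply]
      rw [e₁] at hb'
      have hf₃ : Fits ρ env (f + 1) (f + 3)
          (update (update (update (update g f j) (f + 1) (acc (j + 1))) (f + 2) B) (f + 1) 0) := by
        constructor <;> grind [update_apply]
      refine .seq (.op (s' := ⟨[], w, o, update (update g f j) (f + 1) (acc (j + 1))⟩) ?_)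
        (.seq hb' (.seq ((execIn_clearReg _ _).mono ?_)
        (((hc w o ρ env _ _ _ N hN hf₃).seq
          ((execIn_subReg (by omega) _).mono ?_)).congr ?_ le_rfl)))
      · simp only [Op.apply, Mem.mk.injEq, true_and]
        funext k
        grind [update_apply]
      · grind [update_apply]
      · grind [update_apply]
      · rw [ej]
        funext k
        grind [update_apply]

end Expr

end GrundyDom

/-! ### Functions whose output bits are given by expressions -/

namespace GrundyDom

open Turing StateTransition Function

namespace Expr

variable {A : Type}

/-- The word of length `L` whose bit at position `i` tells whether `b` is nonzero, where `i` is the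
variable `0` and all other variables stand for the length of the input word. -/
def output (L b : Expr A) (w : List A) : List Bool :=
  (List.range (L.eval w fun _ => w.length)).map fun i =>
    decide (b.eval w (update (fun _ => w.length) 0 i) ≠ 0)

/-- The program that computes `Expr.output L b`. The counter `0` holds the length of the input, and
the counter `1` the positions of the output in decreasing order. -/
def outputProg (L b : Expr A) : Prog A :=
  .seq (.loop .more (.seq (.op (.inc 0)) (.seq (.op (.inc 1)) (.op .right))))
  (.seq (.loop (.pos 1) (.seq (.op (.dec 1)) (.op .left)))
  (.seq (L.compile (fun _ => 0) 1 2)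
  (.seq (.loop (.pos 1) (.seq (.op (.dec 1)) (.seq
    (b.compile (update (fun _ => 0) 0 1) 2 3) (.seq (.op (.emit 2)) (clearReg 2)))))
  (.seq (clearReg 0) (.loop .more (.op .erase))))))

/-- The counters of `outputProg` between its parts. -/
def outputReg (n i k : ℕ) : ℕ := if k = 0 then n else if k = 1 then i else 0

theorem execIn_scan (w : List A) :
    ExecIn (.loop .more (.seq (.op (.inc 0)) (.seq (.op (.inc 1)) (.op .right))))
      ⟨[], w, [], fun _ => 0⟩ (w.length * 4 + 1)
      ⟨w.reverse, [], [], outputReg w.length w.length⟩ := by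
  have h := ExecIn.loop (A := A) (T := .more)
    (p := .seq (.op (.inc 0)) (.seq (.op (.inc 1)) (.op .right))) (B := 1 + (1 + 1))
    (fun j => ⟨(w.take (w.length - j)).reverse, w.drop (w.length - j), [],
      outputReg (w.length - j) (w.length - j)⟩)
    (by simp [Test.Holds]) w.length
    (fun j hj => ⟨by simp only [Test.Holds, ne_eq, List.drop_eq_nil_iff]; omega,
      .seq (.op rfl) (.seq (.op rfl) (.op ?_))⟩)
  · have e : outputReg 0 0 = fun _ => 0 := by
      funext k
      grind [update_apply, outputReg]
    simpa [e] using h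
  · refine (right_apply _ _ _ _).trans ?_
    rw [(show w.length - (j + 1) + 1 = w.length - j by omega)]
    simp only [Op.apply, Mem.mk.injEq, true_and]
    funext k
    grind [update_apply, outputReg]

theorem execIn_rewind (w : List A) :
    ExecIn (.loop (.pos 1) (.seq (.op (.dec 1)) (.op .left)))
      ⟨w.reverse, [], [], outputReg w.length w.length⟩ (w.length * 3 + 1)
      ⟨[], w, [], outputReg w.length 0⟩ := by
  have h := ExecIn.loop (A := A) (T := .pos 1)
    (p := .seq (.op (.dec 1)) (.op .left)) (B := 1 + 1)
    (fun j => ⟨(w.take j).reverse, w.drop j, [], outputReg w.length j⟩)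
    (by simp [Test.Holds, outputReg]) w.length
    (fun j hj => ⟨by simp [Test.Holds, outputReg], .seq (.op rfl) (.op ?_)⟩)
  · simpa using h
  · refine (left_apply _ _ _ (by omega)).trans ?_
    simp only [Mem.mk.injEq, true_and, Nat.add_sub_cancel]
    funext k
    grind [update_apply, outputReg]

theorem execIn_eraseAll (w : List A) (o : List Bool) (g : ℕ → ℕ) :
    ExecIn (.loop .more (.op .erase)) ⟨[], w, o, g⟩ (w.length * 2 + 1) ⟨[], [], o, g⟩ := by
  have h := ExecIn.loop (A := A) (T := .more) (p := .op .erase) (B := 1)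
    (fun j => ⟨[], w.drop (w.length - j), o, g⟩) (by simp [Test.Holds]) w.length
    (fun j hj => ⟨by simp only [Test.Holds, ne_eq, List.drop_eq_nil_iff]; omega, .op ?_⟩)
  · simpa using h
  · simp only [Op.apply, List.tail_drop, (show w.length - (j + 1) + 1 = w.length - j by omega)]

theorem exists_execIn_outputProg (L b : Expr A) :
    ∃ T : Polynomial ℕ, ∀ w : List A, ExecIn (outputProg L b) ⟨[], w, [], fun _ => 0⟩
      (T.eval w.length) ⟨[], [], output L b w, fun _ => 0⟩ := by
  obtain ⟨TL, hL⟩ := exists_execIn_compile L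
  obtain ⟨Tb, hb⟩ := exists_execIn_compile b
  obtain ⟨VL, hVL⟩ := exists_eval_le L
  obtain ⟨Vb, hVb⟩ := exists_eval_le b
  refine ⟨(.X * 4 + 1) + ((.X * 3 + 1) + (TL + ((VL * ((1 + (Tb.comp (.X + VL) +
    (1 + (Vb.comp (.X + VL) * 2 + 1)))) + 1) + 1) + ((.X * 2 + 1) + (.X * 2 + 1))))),
    fun w => ?_⟩
  set n := w.length with hn
  set ρ : ℕ → ℕ := fun _ => n with hρ
  set v := L.eval w ρ with hv
  have hv' : v ≤ VL.eval n := hVL w ρ n fun _ => le_rfl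
  have h₁ := hL w [] ρ (fun _ => 0) 1 2 (outputReg n 0) n (fun _ => le_rfl) (by
    constructor <;> grind [update_apply, outputReg])
  have e₁ : update (outputReg n 0) 1 (outputReg n 0 1 + L.eval w ρ) = outputReg n v := by
    funext k
    grind [update_apply, outputReg]
  rw [e₁] at h₁
  have h₂ := ExecIn.loop (A := A) (T := .pos 1)
    (p := .seq (.op (.dec 1)) (.seq
      (b.compile (update (fun _ => 0) 0 1) 2 3) (.seq (.op (.emit 2)) (clearReg 2))))
    (B := 1 + (Tb.eval (n + VL.eval n) + (1 + (Vb.eval (n + VL.eval n) * 2 + 1))))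
    (fun j => ⟨[], w, (List.range' j (v - j)).map fun i =>
      decide (b.eval w (update ρ 0 i) ≠ 0), outputReg n j⟩)
    (by simp [Test.Holds, outputReg]) v
    (fun j hj => ⟨by simp [Test.Holds, outputReg], ?_⟩)
  · rw [Nat.sub_self, List.range'_zero, List.map_nil, Nat.sub_zero] at h₂
    have h₃ := (execIn_scan w).seq ((execIn_rewind w).seq (h₁.seq (h₂.seq
      ((execIn_clearReg 0 _).seq (execIn_eraseAll _ _ _)))))
    have e₂ : update (outputReg n 0) 0 0 = fun _ => 0 := by
      funext k
      grind [update_apply, outputReg]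
    rw [e₂] at h₃
    rw [output, List.range_eq_range', ← hn, ← hρ, ← hv]
    refine h₃.mono ?_
    have e₃ : outputReg n 0 0 = n := rfl
    simp only [Polynomial.eval_add, Polynomial.eval_mul, Polynomial.eval_one,
      Polynomial.eval_comp, Polynomial.eval_X, Polynomial.eval_ofNat, e₃, ← hn]
    gcongr
  · have hρ' : ∀ y, update ρ 0 j y ≤ n + VL.eval n := by
      grind [update_apply]
    have hV := hVb w _ _ hρ'
    have hb' := hb w ((List.range' (j + 1) (v - (j + 1))).map fun i =>
      decide (b.eval w (update ρ 0 i) ≠ 0)) (update ρ 0 j) (update (fun _ => 0) 0 1) 2 3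
      (outputReg n j) _ hρ' (by constructor <;> grind [update_apply, outputReg])
    have e₂ : outputReg n j 2 + b.eval w (update ρ 0 j) = b.eval w (update ρ 0 j) := by
      grind [update_apply, outputReg]
    rw [e₂] at hb'
    have e₃ : v - j = v - (j + 1) + 1 := by omega
    rw [e₃, List.range'_succ, List.map_cons]
    refine .seq (.op ?_) (hb'.seq (.seq (.op (s' := ⟨[], w, decide (b.eval w (update ρ 0 j) ≠ 0) ::
      (List.range' (j + 1) (v - (j + 1))).map fun i => decide (b.eval w (update ρ 0 i) ≠ 0),
      update (outputReg n j) 2 (b.eval w (update ρ 0 j))⟩) ?_)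
      ((execIn_clearReg _ _).congr ?_ ?_)))
    · simp only [Op.apply, Mem.mk.injEq, true_and]
      funext k
      grind [update_apply, outputReg]
    · simp [Op.apply]
    · funext k
      grind [update_apply, outputReg]
    · rw [update_self]
      omega

/-- Functions whose output bits are given by expressions are computable in polynomial time. -/
theorem nonempty_computableInPolyTime [Inhabited A] [Fintype A] {α β : Type} {ea : α → List A}
    {eb : β → List Bool} {F : α → β} (L b : Expr A) (h : ∀ a, eb (F a) = output L b (ea a)) :
    Nonempty (TM2ComputableInPolyTime ea eb F) := by
  obtain ⟨T, hT⟩ := exists_execIn_outputProg L b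
  refine ⟨⟨⟨(outputProg L b).machine, Equiv.refl A, Equiv.refl Bool⟩, T + 1,
    fun a => Classical.choice (nonempty_outputsInTime.2 ?_)⟩⟩
  obtain ⟨t, ht, hE⟩ := hT (ea a)
  refine ⟨t + 1, by simpa using ht, ?_⟩
  have e₁ : (ea a).map (Equiv.refl A).invFun = ea a := List.map_id _
  have e₂ : (eb (F a)).map (Equiv.refl Bool).invFun = output L b (ea a) := by
    rw [← h]
    exact List.map_id _
  convert hE.outputs using 2
  · exact congrArg (initList (outputProg L b).machine) e₁
  · exact congrArg (haltList (outputProg L b).machine) e₂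

end Expr

end GrundyDom

/-! ### Composition of polynomial-time machines -/

namespace GrundyDom

open Turing StateTransition Function

section Embedding

variable {K₀ K Λ₀ Λ σ₀ σ : Type} {Γ : K → Type}

/-- A statement, transported along an embedding `ι` of the stacks, with the local state accessed by
`get` and `set`, labels renamed by `lab`, and halting replaced by a jump to `exit`. -/
def embedStmt (ι : K₀ → K) (get : σ → σ₀) (set : σ → σ₀ → σ) (lab : Λ₀ → Λ) (exit : Λ) :
    TM2.Stmt (fun k => Γ (ι k)) Λ₀ σ₀ → TM2.Stmt Γ Λ σ
  | .push k f q => .push (ι k) (fun s => f (get s)) (embedStmt ι get set lab exit q)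
  | .peek k f q => .peek (ι k) (fun s o => set s (f (get s) o)) (embedStmt ι get set lab exit q)
  | .pop k f q => .pop (ι k) (fun s o => set s (f (get s) o)) (embedStmt ι get set lab exit q)
  | .load f q => .load (fun s => set s (f (get s))) (embedStmt ι get set lab exit q)
  | .branch f q r =>
    .branch (fun s => f (get s)) (embedStmt ι get set lab exit q) (embedStmt ι get set lab exit r)
  | .goto f => .goto fun s => lab (f (get s))
  | .halt => .goto fun _ => exit

/-- The stacks `S` consist of the stacks `S₀`, placed by `ι`, and agree with `F` elsewhere. -/
def Extends (ι : K₀ → K) (F : ∀ k, List (Γ k)) (S₀ : ∀ k, List (Γ (ι k)))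
    (S : ∀ k, List (Γ k)) : Prop :=
  (∀ k, S (ι k) = S₀ k) ∧ ∀ k, k ∉ Set.range ι → S k = F k

variable [DecidableEq K₀] [DecidableEq K]

theorem Extends.update {ι : K₀ → K} (hι : Injective ι) {F : ∀ k, List (Γ k)}
    {S₀ : ∀ k, List (Γ (ι k))} {S : ∀ k, List (Γ k)} (h : Extends ι F S₀ S) (k : K₀)
    (l : List (Γ (ι k))) : Extends ι F (update S₀ k l) (update S (ι k) l) := by
  constructor
  · intro j
    by_cases hj : j = k
    · subst hj
      simp
    · rw [update_of_ne (hι.ne hj), update_of_ne hj, h.1]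
  · intro j hj
    rw [update_of_ne (fun e => hj ⟨k, e.symm⟩), h.2 j hj]

/-- The configuration `c` simulates the configuration `c₀` of an embedded machine. -/
def Simulates (ι : K₀ → K) (F : ∀ k, List (Γ k)) (st : σ₀ → σ) (lab : Λ₀ → Λ) (exit : Λ)
    (c₀ : TM2.Cfg (fun k => Γ (ι k)) Λ₀ σ₀) (c : TM2.Cfg Γ Λ σ) : Prop :=
  c.l = some (c₀.l.elim exit lab) ∧ c.var = st c₀.var ∧ Extends ι F c₀.stk c.stk

theorem simulates_stepAux {ι : K₀ → K} (hι : Injective ι) {F : ∀ k, List (Γ k)}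
    {st : σ₀ → σ} {get : σ → σ₀} {set : σ → σ₀ → σ} (hget : ∀ a, get (st a) = a)
    (hset : ∀ a b, set (st a) b = st b) {lab : Λ₀ → Λ} {exit : Λ}
    (q : TM2.Stmt (fun k => Γ (ι k)) Λ₀ σ₀) (v : σ₀)
    (S₀ : ∀ k, List (Γ (ι k))) (S : ∀ k, List (Γ k)) (h : Extends ι F S₀ S) :
    Simulates ι F st lab exit (TM2.stepAux q v S₀)
      (TM2.stepAux (embedStmt ι get set lab exit q) (st v) S) := by
  induction q generalizing v S₀ S with
  | push k f q ih =>
    simp only [embedStmt, TM2.stepAux, hget, h.1]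
    exact ih _ _ _ (h.update hι k _)
  | peek k f q ih =>
    simp only [embedStmt, TM2.stepAux, hget, hset, h.1]
    exact ih _ _ _ h
  | pop k f q ih =>
    simp only [embedStmt, TM2.stepAux, hget, hset, h.1]
    exact ih _ _ _ (h.update hι k _)
  | load f q ih =>
    simp only [embedStmt, TM2.stepAux, hget, hset]
    exact ih _ _ _ h
  | branch f q r ihq ihr =>
    simp only [embedStmt, TM2.stepAux, hget]
    cases f v
    · exact ihr _ _ _ h
    · exact ihq _ _ _ h
  | goto f => exact ⟨by simp [embedStmt, hget], rfl, h⟩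
  | halt => exact ⟨rfl, rfl, h⟩

/-- An embedded machine is simulated step by step. -/
theorem simulates_stepsTo {ι : K₀ → K} (hι : Injective ι) {F : ∀ k, List (Γ k)}
    {st : σ₀ → σ} {get : σ → σ₀} {set : σ → σ₀ → σ} (hget : ∀ a, get (st a) = a)
    (hset : ∀ a b, set (st a) b = st b) {lab : Λ₀ → Λ} {exit : Λ}
    {M₀ : Λ₀ → TM2.Stmt (fun k => Γ (ι k)) Λ₀ σ₀}
    {M : Λ → TM2.Stmt Γ Λ σ} (hM : ∀ l, M (lab l) = embedStmt ι get set lab exit (M₀ l))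
    {t : ℕ} {c₀ c₀' : TM2.Cfg (fun k => Γ (ι k)) Λ₀ σ₀} (h : StepsTo (TM2.step M₀) t c₀ c₀')
    {c : TM2.Cfg Γ Λ σ} (hc : Simulates ι F st lab exit c₀ c) :
    ∃ c', StepsTo (TM2.step M) t c c' ∧ Simulates ι F st lab exit c₀' c' := by
  induction t generalizing c₀ c with
  | zero =>
    obtain rfl : c₀ = c₀' := Option.some.inj h
    exact ⟨c, .refl c, hc⟩
  | succ t ih =>
    obtain ⟨c₁, hc₁, h⟩ := StepsTo.succ_iff.1 h
    obtain ⟨_ | l₀, v₀, S₀⟩ := c₀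
    · simp at hc₁
    obtain ⟨l, v, S⟩ := c
    obtain ⟨rfl, rfl, hS⟩ := hc
    obtain rfl : TM2.stepAux (M₀ l₀) v₀ S₀ = c₁ := Option.some.inj hc₁
    obtain ⟨c', h', hc'⟩ := ih h
      (simulates_stepAux hι hget hset (lab := lab) (exit := exit) (M₀ l₀) v₀ S₀ S hS)
    refine ⟨c', StepsTo.succ_iff.2 ⟨_, ?_, h'⟩, hc'⟩
    simp only [TM2.step, Option.elim_some, hM]

end Embedding

section Growth

variable {K Λ σ : Type} {Γ : K → Type} [DecidableEq K]

/-- An upper bound for the number of letters that a statement pushes. -/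
def pushCount : TM2.Stmt Γ Λ σ → ℕ
  | .push _ _ q => pushCount q + 1
  | .peek _ _ q => pushCount q
  | .pop _ _ q => pushCount q
  | .load _ q => pushCount q
  | .branch _ q r => pushCount q + pushCount r
  | .goto _ => 0
  | .halt => 0

theorem length_stepAux_le (q : TM2.Stmt Γ Λ σ) (v : σ) (S : ∀ k, List (Γ k)) (k : K) :
    ((TM2.stepAux q v S).stk k).length ≤ (S k).length + pushCount q := by
  induction q generalizing v S with
  | push j f q ih =>
    refine (ih _ _).trans ?_
    simp only [pushCount]
    by_cases h : k = j
    · subst h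
      simp
      omega
    · rw [update_of_ne h]
      omega
  | peek j f q ih => exact ih _ _
  | pop j f q ih =>
    refine (ih _ _).trans ?_
    simp only [pushCount]
    by_cases h : k = j
    · subst h
      simp
    · rw [update_of_ne h]
  | load f q ih => exact ih _ _
  | branch f q r ihq ihr =>
    simp only [TM2.stepAux, pushCount]
    cases f v
    · exact (ihr _ _).trans (by omega)
    · exact (ihq _ _).trans (by omega)
  | goto f => simp [pushCount]
  | halt => simp [pushCount]

/-- Stacks grow at most linearly in the number of steps. -/
theorem length_le_of_stepsTo [Fintype Λ] {M : Λ → TM2.Stmt Γ Λ σ} {t : ℕ}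
    {c c' : TM2.Cfg Γ Λ σ} (h : StepsTo (TM2.step M) t c c') (k : K) :
    (c'.stk k).length ≤ (c.stk k).length + (∑ l, pushCount (M l)) * t := by
  induction t generalizing c with
  | zero =>
    obtain rfl : c = c' := Option.some.inj h
    simp
  | succ t ih =>
    obtain ⟨c₁, hc₁, h⟩ := StepsTo.succ_iff.1 h
    obtain ⟨_ | l, v, S⟩ := c
    · simp at hc₁
    obtain rfl : TM2.stepAux (M l) v S = c₁ := Option.some.inj hc₁
    have h₁ := length_stepAux_le (M l) v S k
    have h₂ : pushCount (M l) ≤ ∑ l, pushCount (M l) :=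
      Finset.single_le_sum (f := fun l => pushCount (M l)) (fun _ _ => Nat.zero_le _)
        (Finset.mem_univ l)
    have := ih h
    rw [Nat.mul_succ]
    simp only
    omega

end Growth

section Composition

variable {B : Type} (M₁ M₂ : FinTM2) (e₁ : M₁.Γ M₁.k₁ ≃ B) (e₂ : M₂.Γ M₂.k₀ ≃ B)

/-- The stack alphabets of the composition: those of the two machines and the alphabet of an
auxiliary stack `none`. -/
abbrev CompAlph (B : Type) (M₁ M₂ : FinTM2) : Option (M₁.K ⊕ M₂.K) → Type
  | none => B
  | some (.inl k) => M₁.Γ k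
  | some (.inr k) => M₂.Γ k

/-- The labels of the composition: those of the two machines, and the labels `0`, `1` for copying
and `2` for halting. -/
abbrev CompLabel (M₁ M₂ : FinTM2) : Type := (M₁.Λ ⊕ M₂.Λ) ⊕ Fin 3

/-- The local states of the composition: those of the two machines and a buffer. -/
abbrev CompState (B : Type) (M₁ M₂ : FinTM2) : Type := (M₁.σ × M₂.σ) × Option B

/-- The code of the composition. The output of the first machine is moved to the auxiliary stack
and from there to the input stack of the second one, so that its order is kept. -/
def compCode [Inhabited B] :
    CompLabel M₁ M₂ → TM2.Stmt (CompAlph B M₁ M₂) (CompLabel M₁ M₂) (CompState B M₁ M₂)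
  | .inl (.inl l) =>
    embedStmt (Γ := CompAlph B M₁ M₂) (fun k => some (.inl k)) (fun s => s.1.1)
      (fun s a => ((a, s.1.2), s.2)) (fun l => .inl (.inl l)) (.inr 0) (M₁.m l)
  | .inl (.inr l) =>
    embedStmt (Γ := CompAlph B M₁ M₂) (fun k => some (.inr k)) (fun s => s.1.2)
      (fun s a => ((s.1.1, a), s.2)) (fun l => .inl (.inr l)) (.inr 2) (M₂.m l)
  | .inr 0 =>
    .pop (some (.inl M₁.k₁)) (fun s o => (s.1, o.map e₁))
      (.branch (fun s => s.2.isSome)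
        (.push none (fun s => s.2.getD default) (.load (fun s => (s.1, none))
          (.goto fun _ => .inr 0)))
        (.goto fun _ => .inr 1))
  | .inr 1 =>
    .pop none (fun s o => (s.1, o))
      (.branch (fun s => s.2.isSome)
        (.push (some (.inr M₂.k₀)) (fun s => e₂.symm (s.2.getD default))
          (.load (fun s => (s.1, none)) (.goto fun _ => .inr 1)))
        (.goto fun _ => .inl (.inr M₂.main)))
  | .inr 2 => .halt

/-- The composition of two machines. -/
def compMachine [Inhabited B] [Fintype B] : FinTM2 where
  K := Option (M₁.K ⊕ M₂.K)
  kDecidableEq := inferInstance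
  kFin := by
    have := M₁.kFin
    have := M₂.kFin
    infer_instance
  k₀ := some (.inl M₁.k₀)
  k₁ := some (.inr M₂.k₁)
  Γ := CompAlph B M₁ M₂
  Λ := CompLabel M₁ M₂
  main := .inl (.inl M₁.main)
  ΛFin := by
    have := M₁.ΛFin
    have := M₂.ΛFin
    infer_instance
  σ := CompState B M₁ M₂
  initialState := ((M₁.initialState, M₂.initialState), none)
  σFin := by
    have := M₁.σFin
    have := M₂.σFin
    infer_instance
  Γk₀Fin := M₁.Γk₀Fin
  m := compCode M₁ M₂ e₁ e₂

/-- Stack contents of the composition. -/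
def compStacks (S₁ : ∀ k, List (M₁.Γ k)) (S₂ : ∀ k, List (M₂.Γ k)) (a : List B) :
    ∀ k, List (CompAlph B M₁ M₂ k)
  | none => a
  | some (.inl k) => S₁ k
  | some (.inr k) => S₂ k

variable {M₁ M₂}

theorem update_compStacks_none (S₁ : ∀ k, List (M₁.Γ k)) (S₂ : ∀ k, List (M₂.Γ k)) (a b : List B) :
    update (compStacks M₁ M₂ S₁ S₂ a) none b = compStacks M₁ M₂ S₁ S₂ b := by
  funext k
  rcases k with _ | k | k <;> simp [compStacks]

theorem update_compStacks_inl (S₁ : ∀ k, List (M₁.Γ k)) (S₂ : ∀ k, List (M₂.Γ k)) (a : List B)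
    (k : M₁.K) (l : List (M₁.Γ k)) :
    update (compStacks M₁ M₂ S₁ S₂ a) (some (.inl k)) l =
      compStacks M₁ M₂ (update S₁ k l) S₂ a := by
  funext j
  rcases j with _ | j | j
  · simp [compStacks]
  · by_cases h : j = k
    · subst h
      simp [compStacks]
    · rw [update_of_ne (by simpa using h)]
      simp [compStacks, h]
  · simp [compStacks]

theorem update_compStacks_inr (S₁ : ∀ k, List (M₁.Γ k)) (S₂ : ∀ k, List (M₂.Γ k)) (a : List B)
    (k : M₂.K) (l : List (M₂.Γ k)) :
    update (compStacks M₁ M₂ S₁ S₂ a) (some (.inr k)) l =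
      compStacks M₁ M₂ S₁ (update S₂ k l) a := by
  funext j
  rcases j with _ | j | j
  · simp [compStacks]
  · simp [compStacks]
  · by_cases h : j = k
    · subst h
      simp [compStacks]
    · rw [update_of_ne (by simpa using h)]
      simp [compStacks, h]

/-- The stacks that are empty except for `l` on the stack `k`. -/
def singleStack (M : FinTM2) (k : M.K) (l : List (M.Γ k)) : ∀ j, List (M.Γ j) :=
  update (fun _ => []) k l

theorem initList_eq (M : FinTM2) (x : List (M.Γ M.k₀)) :
    initList M x = ⟨some M.main, M.initialState, singleStack M M.k₀ x⟩ := by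
  refine congrArg (TM2.Cfg.mk _ _) (funext fun k => ?_)
  by_cases h : k = M.k₀
  · subst h
    simp [singleStack]
  · simp [singleStack, h]

theorem haltList_eq (M : FinTM2) (x : List (M.Γ M.k₁)) :
    haltList M x = ⟨none, M.initialState, singleStack M M.k₁ x⟩ := by
  refine congrArg (TM2.Cfg.mk _ _) (funext fun k => ?_)
  by_cases h : k = M.k₁
  · subst h
    simp [singleStack]
  · simp [singleStack, h]

theorem stepsTo_copyOut [Inhabited B] (v : M₁.σ × M₂.σ) (S₂ : ∀ k, List (M₂.Γ k))
    (l : List (M₁.Γ M₁.k₁)) (a : List B) :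
    StepsTo (TM2.step (compCode M₁ M₂ e₁ e₂)) (l.length + 1)
      ⟨some (.inr 0), (v, none), compStacks M₁ M₂ (singleStack M₁ M₁.k₁ l) S₂ a⟩
      ⟨some (.inr 1), (v, none),
        compStacks M₁ M₂ (singleStack M₁ M₁.k₁ []) S₂ ((l.map e₁).reverse ++ a)⟩ := by
  induction l generalizing a with
  | nil =>
    refine StepsTo.single ?_
    simp [TM2.step, compCode, TM2.stepAux, update_compStacks_inl]
    simp [compStacks, singleStack]
  | cons b l ih =>
    rw [List.length_cons]
    refine StepsTo.succ_iff.2 ⟨_, ?_, by simpa using ih (e₁ b :: a)⟩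
    simp [TM2.step, compCode, TM2.stepAux, update_compStacks_inl, update_compStacks_none]
    simp [compStacks, singleStack]

theorem stepsTo_copyIn [Inhabited B] (v : M₁.σ × M₂.σ) (S₁ : ∀ k, List (M₁.Γ k))
    (l : List (M₂.Γ M₂.k₀)) (a : List B) :
    StepsTo (TM2.step (compCode M₁ M₂ e₁ e₂)) (a.length + 1)
      ⟨some (.inr 1), (v, none), compStacks M₁ M₂ S₁ (singleStack M₂ M₂.k₀ l) a⟩
      ⟨some (.inl (.inr M₂.main)), (v, none),
        compStacks M₁ M₂ S₁ (singleStack M₂ M₂.k₀ ((a.map e₂.symm).reverse ++ l)) []⟩ := by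
  induction a generalizing l with
  | nil =>
    refine StepsTo.single ?_
    simp [TM2.step, compCode, TM2.stepAux, update_compStacks_none]
    simp [compStacks, singleStack]
  | cons b a ih =>
    rw [List.length_cons]
    refine StepsTo.succ_iff.2 ⟨_, ?_, by simpa using ih (e₂.symm b :: l)⟩
    simp [TM2.step, compCode, TM2.stepAux, update_compStacks_inr, update_compStacks_none]
    simp [compStacks, singleStack]

theorem singleStack_nil (M : FinTM2) (k : M.K) : singleStack M k [] = fun _ => [] :=
  update_eq_self k _

theorem initList_compMachine [Inhabited B] [Fintype B] (x : List (M₁.Γ M₁.k₀)) :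
    initList (compMachine M₁ M₂ e₁ e₂) x =
      ⟨some (.inl (.inl M₁.main)), ((M₁.initialState, M₂.initialState), none),
        compStacks M₁ M₂ (singleStack M₁ M₁.k₀ x) (fun _ => []) []⟩ := by
  refine (initList_eq (compMachine M₁ M₂ e₁ e₂) x).trans ?_
  refine congrArg (TM2.Cfg.mk _ _) (Eq.trans ?_ (update_compStacks_inl (fun _ => []) (fun _ => [])
    [] M₁.k₀ x))
  refine congrArg (fun S : ∀ k, List (CompAlph B M₁ M₂ k) => update S (some (.inl M₁.k₀)) x)
    (funext fun k => ?_)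
  rcases k with _ | k | k <;> rfl

theorem haltList_compMachine [Inhabited B] [Fintype B] (z : List (M₂.Γ M₂.k₁)) :
    haltList (compMachine M₁ M₂ e₁ e₂) z =
      ⟨none, ((M₁.initialState, M₂.initialState), none),
        compStacks M₁ M₂ (fun _ => []) (singleStack M₂ M₂.k₁ z) []⟩ := by
  refine (haltList_eq (compMachine M₁ M₂ e₁ e₂) z).trans ?_
  refine congrArg (TM2.Cfg.mk _ _) (Eq.trans ?_ (update_compStacks_inr (fun _ => []) (fun _ => [])
    [] M₂.k₁ z))
  refine congrArg (fun S : ∀ k, List (CompAlph B M₁ M₂ k) => update S (some (.inr M₂.k₁)) z)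
    (funext fun k => ?_)
  rcases k with _ | k | k <;> rfl

theorem stepsTo_compMachine [Inhabited B] [Fintype B] {x : List (M₁.Γ M₁.k₀)} (u : List B)
    {z : List (M₂.Γ M₂.k₁)} {t₁ t₂ : ℕ}
    (h₁ : StepsTo M₁.step t₁ (initList M₁ x) (haltList M₁ (u.map e₁.symm)))
    (h₂ : StepsTo M₂.step t₂ (initList M₂ (u.map e₂.symm)) (haltList M₂ z)) :
    StepsTo (compMachine M₁ M₂ e₁ e₂).step
      (t₁ + ((u.length + 1) + ((u.length + 1) + (t₂ + 1))))
      (initList (compMachine M₁ M₂ e₁ e₂) x) (haltList (compMachine M₁ M₂ e₁ e₂) z) := by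
  rw [initList_compMachine, haltList_compMachine]
  rw [initList_eq, haltList_eq] at h₁ h₂
  have r₁ := simulates_stepsTo (Γ := CompAlph B M₁ M₂) (ι := fun k : M₁.K => some (.inl k))
    (fun a b h => by simpa using h) (F := compStacks M₁ M₂ (fun _ => []) (fun _ => []) [])
    (st := fun a => ((a, M₂.initialState), none)) (get := fun s : CompState B M₁ M₂ => s.1.1)
    (set := fun s a => ((a, s.1.2), s.2)) (fun _ => rfl) (fun _ _ => rfl)
    (lab := fun l => .inl (.inl l)) (exit := .inr 0)
    (M := compCode M₁ M₂ e₁ e₂) (fun _ => rfl) h₁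
    (c := ⟨some (.inl (.inl M₁.main)), ((M₁.initialState, M₂.initialState), none),
      compStacks M₁ M₂ (singleStack M₁ M₁.k₀ x) (fun _ => []) []⟩)
    ⟨rfl, rfl, fun _ => rfl, fun k hk => by
      rcases k with _ | k | k
      · rfl
      · exact absurd ⟨k, rfl⟩ hk
      · rfl⟩
  have r₂ := simulates_stepsTo (Γ := CompAlph B M₁ M₂) (ι := fun k : M₂.K => some (.inr k))
    (fun a b h => by simpa using h) (F := compStacks M₁ M₂ (fun _ => []) (fun _ => []) [])
    (st := fun a => ((M₁.initialState, a), none)) (get := fun s : CompState B M₁ M₂ => s.1.2)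
    (set := fun s a => ((s.1.1, a), s.2)) (fun _ => rfl) (fun _ _ => rfl)
    (lab := fun l => .inl (.inr l)) (exit := .inr 2)
    (M := compCode M₁ M₂ e₁ e₂) (fun _ => rfl) h₂
    (c := ⟨some (.inl (.inr M₂.main)), ((M₁.initialState, M₂.initialState), none),
      compStacks M₁ M₂ (fun _ => []) (singleStack M₂ M₂.k₀ (u.map e₂.symm)) []⟩)
    ⟨rfl, rfl, fun _ => rfl, fun k hk => by
      rcases k with _ | k | k
      · rfl
      · rfl
      · exact absurd ⟨k, rfl⟩ hk⟩
  obtain ⟨⟨l₁, v₁, S₁⟩, r₁, hl₁, hv₁, hS₁, hS₁'⟩ := r₁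
  obtain ⟨⟨l₂, v₂, S₂⟩, r₂, hl₂, hv₂, hS₂, hS₂'⟩ := r₂
  obtain rfl : l₁ = some (.inr 0) := hl₁
  obtain rfl : l₂ = some (.inr 2) := hl₂
  obtain rfl : v₁ = ((M₁.initialState, M₂.initialState), none) := hv₁
  obtain rfl : v₂ = ((M₁.initialState, M₂.initialState), none) := hv₂
  obtain rfl : S₁ = compStacks M₁ M₂ (singleStack M₁ M₁.k₁ (u.map e₁.symm))
      (singleStack M₂ M₂.k₀ []) [] := by
    rw [singleStack_nil]
    funext k
    rcases k with _ | k | k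
    · exact hS₁' _ (by simp)
    · exact hS₁ k
    · exact hS₁' _ (by simp)
  obtain rfl : S₂ = compStacks M₁ M₂ (fun _ => []) (singleStack M₂ M₂.k₁ z) [] := by
    funext k
    rcases k with _ | k | k
    · exact hS₂' _ (by simp)
    · exact hS₂' _ (by simp)
    · exact hS₂ k
  have c₁ := stepsTo_copyOut e₁ e₂ (M₁.initialState, M₂.initialState)
    (singleStack M₂ M₂.k₀ []) (u.map e₁.symm) []
  have c₂ := stepsTo_copyIn e₁ e₂ (M₁.initialState, M₂.initialState) (singleStack M₁ M₁.k₁ []) []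
    u.reverse
  have a₁ : ((u.map e₁.symm).map e₁).reverse ++ [] = u.reverse := by simp
  have a₂ : (u.reverse.map e₂.symm).reverse ++ [] = u.map e₂.symm := by
    rw [List.append_nil, ← List.map_reverse, List.reverse_reverse]
  rw [a₁] at c₁
  rw [a₂, singleStack_nil M₁] at c₂
  rw [singleStack_nil M₁] at c₁
  rw [List.length_map] at c₁
  rw [List.length_reverse] at c₂
  exact r₁.trans (c₁.trans (c₂.trans (r₂.trans (StepsTo.single rfl))))

/-- Polynomial-time functions can be composed. The letters written by the first machine are
bounded by its running time, so that the second machine runs on a word of polynomial length. -/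
theorem nonempty_computableInPolyTime_comp [Inhabited B] [Fintype B] {α β γ A C : Type}
    {eα : α → List A} {eβ : β → List B} {eγ : γ → List C} {f : α → β} {g : β → γ}
    (hf : TM2ComputableInPolyTime eα eβ f) (hg : TM2ComputableInPolyTime eβ eγ g) :
    Nonempty (TM2ComputableInPolyTime eα eγ (g ∘ f)) := by
  obtain ⟨⟨M₁, i₁, o₁⟩, T₁, h₁⟩ := hf
  obtain ⟨⟨M₂, i₂, o₂⟩, T₂, h₂⟩ := hg
  have := M₁.ΛFin
  set c := ∑ l, pushCount (M₁.m l) with hc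
  set U : Polynomial ℕ := .X + Polynomial.C c * T₁ with hU
  refine ⟨⟨⟨compMachine M₁ M₂ o₁ i₂, i₁, o₂⟩, T₁ + ((U + 1) + ((U + 1) + (T₂.comp U + 1))),
    fun a => Classical.choice (nonempty_outputsInTime.2 ?_)⟩⟩
  obtain ⟨t₁, ht₁, s₁⟩ := nonempty_outputsInTime.1 ⟨h₁ a⟩
  obtain ⟨t₂, ht₂, s₂⟩ := nonempty_outputsInTime.1 ⟨h₂ (f a)⟩
  have hlen : (eβ (f a)).length ≤ U.eval (eα a).length := by
    have h := length_le_of_stepsTo s₁ M₁.k₁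
    rw [initList_eq, haltList_eq] at h
    have h' : (singleStack M₁ M₁.k₀ ((eα a).map i₁.invFun) M₁.k₁).length ≤ (eα a).length := by
      by_cases e : M₁.k₁ = M₁.k₀
      · have : ∀ k, (singleStack M₁ M₁.k₀ ((eα a).map i₁.invFun) k).length ≤ (eα a).length := by
          intro k
          by_cases e : k = M₁.k₀
          · subst e
            simp [singleStack]
          · simp [singleStack, e]
        exact this _
      · simp [singleStack, e]
    have h'' : (singleStack M₁ M₁.k₁ ((eβ (f a)).map o₁.invFun) M₁.k₁).length =
        (eβ (f a)).length := by simp [singleStack]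
    have : c * t₁ ≤ c * T₁.eval (eα a).length := Nat.mul_le_mul_left _ ht₁
    simp only [hU, Polynomial.eval_add, Polynomial.eval_mul, Polynomial.eval_X, Polynomial.eval_C]
    refine (h''.symm.le.trans h).trans ?_
    exact add_le_add h' this
  refine ⟨_, ?_, stepsTo_compMachine o₁ i₂ (eβ (f a)) s₁ s₂⟩
  have := ht₂.trans (polynomial_eval_mono T₂ hlen)
  simp only [Polynomial.eval_add, Polynomial.eval_one, Polynomial.eval_comp]
  omega

end Composition

end GrundyDom

/-! ### Arithmetic and logic by expressions -/

namespace GrundyDom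

open Function

namespace Expr

variable {A : Type} {w : List A} {ρ ρ' : ℕ → ℕ}

/-- A number above the names of all variables that occur in an expression. -/
def names : Expr A → ℕ
  | var x => x + 1
  | one => 0
  | add a b => max a.names b.names
  | sub a b => max a.names b.names
  | sym _ e => e.names
  | sum x n b => max (x + 1) (max n.names b.names)
  | fold x y n c b => max (x + 1) (max (y + 1) (max n.names (max c.names b.names)))

theorem eval_congr (e : Expr A) (h : ∀ y < e.names, ρ y = ρ' y) : e.eval w ρ = e.eval w ρ' := by
  induction e generalizing ρ ρ' with
  | var x => exact h x (Nat.lt_succ_self x)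
  | one => rfl
  | add a b iha ihb =>
    simp only [names, lt_max_iff] at h
    rw [eval, eval, iha fun y hy => h y (by tauto), ihb fun y hy => h y (by tauto)]
  | sub a b iha ihb =>
    simp only [names, lt_max_iff] at h
    rw [eval, eval, iha fun y hy => h y (by tauto), ihb fun y hy => h y (by tauto)]
  | sym f e ih => rw [eval, eval, ih h]
  | sum x n b ihn ihb =>
    simp only [names, lt_max_iff] at h
    rw [eval, eval, ihn fun y hy => h y (by tauto)]
    refine Finset.sum_congr rfl fun i _ => ihb fun y hy => ?_
    rw [update_apply, update_apply, h y (by tauto)]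
  | fold x y n c b ihn ihc ihb =>
    simp only [names, lt_max_iff] at h
    rw [eval, eval, ihn fun y hy => h y (by tauto), ihc fun y hy => h y (by tauto)]
    congr 1
    funext i a
    rw [ihb fun z hz => ?_]
    simp only [update_apply]
    rw [h z (by tauto)]

theorem eval_update (e : Expr A) {x : ℕ} (hx : e.names ≤ x) (i : ℕ) :
    e.eval w (update ρ x i) = e.eval w ρ :=
  e.eval_congr fun y hy => update_of_ne (by omega) _ _

/-- The product, as a sum of equal terms. -/
def mul (a b : Expr A) : Expr A := sum b.names a b

/-- The natural number `k`. -/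
def lit : ℕ → Expr A
  | 0 => sub one one
  | k + 1 => add (lit k) one

/-- Negation, where nonzero values stand for truth. -/
def not (a : Expr A) : Expr A := sub one a

/-- `1` or `0`, depending on `a ≤ b`. -/
def le (a b : Expr A) : Expr A := not (sub a b)

/-- `1` or `0`, depending on `a < b`. -/
def lt (a b : Expr A) : Expr A := le (add a one) b

/-- `1` or `0`, depending on `a = b`. -/
def eq (a b : Expr A) : Expr A := mul (le a b) (le b a)

/-- `a` or `b`, depending on `c`. -/
def ite (c a b : Expr A) : Expr A := add (mul (not (not c)) a) (mul (not c) b)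

/-- The quotient, as the number of positive multiples of `b` up to `a`. -/
def div (a b : Expr A) : Expr A :=
  sum (max a.names b.names) a (le (mul (add (var (max a.names b.names)) one) b) a)

/-- The remainder. -/
def mod (a b : Expr A) : Expr A := sub a (mul b (div a b))

/-- The length of the word, provided that the variable `99` holds it. This is the case in
`Expr.output`, because `99` is never bound: the bound variables are numbered by `0`, `1`, `2` and
`10`, by `50`, …, `53`, and by the fresh names in `mul` and `div`. -/
def len : Expr A := var 99

@[simp] theorem eval_var (x : ℕ) : (var x : Expr A).eval w ρ = ρ x := rfl

@[simp] theorem eval_one : (one : Expr A).eval w ρ = 1 := rfl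

@[simp] theorem eval_add (a b : Expr A) : (add a b).eval w ρ = a.eval w ρ + b.eval w ρ := rfl

@[simp] theorem eval_sub (a b : Expr A) : (sub a b).eval w ρ = a.eval w ρ - b.eval w ρ := rfl

@[simp] theorem eval_sym (f : Option A → Bool) (e : Expr A) :
    (sym f e).eval w ρ = if f w[e.eval w ρ]? = true then 1 else 0 := by
  rw [eval]
  cases f w[e.eval w ρ]? <;> simp

@[simp] theorem eval_sum (x : ℕ) (n b : Expr A) : (sum x n b).eval w ρ =
    ∑ i ∈ Finset.range (n.eval w ρ), b.eval w (update ρ x i) := rfl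

@[simp] theorem eval_mul (a b : Expr A) : (mul a b).eval w ρ = a.eval w ρ * b.eval w ρ := by
  simp [mul, eval_update b le_rfl]

@[simp] theorem eval_lit (k : ℕ) : (lit k : Expr A).eval w ρ = k := by
  induction k with
  | zero => simp [lit]
  | succ k ih => simp [lit, ih]

@[simp] theorem eval_not (a : Expr A) :
    (not a).eval w ρ = if a.eval w ρ = 0 then 1 else 0 := by
  rw [not, eval_sub, eval_one]
  split_ifs <;> omega

@[simp] theorem eval_le (a b : Expr A) :
    (le a b).eval w ρ = if a.eval w ρ ≤ b.eval w ρ then 1 else 0 := by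
  simp [le, Nat.sub_eq_zero_iff_le]

@[simp] theorem eval_lt (a b : Expr A) :
    (lt a b).eval w ρ = if a.eval w ρ < b.eval w ρ then 1 else 0 := by
  simp [lt]

@[simp] theorem eval_eq (a b : Expr A) :
    (eq a b).eval w ρ = if a.eval w ρ = b.eval w ρ then 1 else 0 := by
  rw [eq, eval_mul, eval_le, eval_le]
  split_ifs <;> omega

@[simp] theorem eval_ite (c a b : Expr A) :
    (ite c a b).eval w ρ = if c.eval w ρ ≠ 0 then a.eval w ρ else b.eval w ρ := by
  rw [ite, eval_add, eval_mul, eval_mul, eval_not, eval_not]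
  split_ifs <;> simp_all

theorem eval_div (a b : Expr A) (hb : 0 < b.eval w ρ) :
    (div a b).eval w ρ = a.eval w ρ / b.eval w ρ := by
  rw [div, eval_sum]
  simp only [eval_le, eval_mul, eval_add, eval_var, eval_one, update_self,
    eval_update a (le_max_left _ b.names), eval_update b (le_max_right a.names _)]
  rw [Finset.sum_boole, Nat.cast_id]
  have : (Finset.range (a.eval w ρ)).filter (fun q => (q + 1) * b.eval w ρ ≤ a.eval w ρ) =
      Finset.range (a.eval w ρ / b.eval w ρ) := by
    ext q
    rw [Finset.mem_filter, Finset.mem_range, Finset.mem_range, 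
      ← Nat.succ_le_iff (m := q) (n := _ / _), Nat.le_div_iff_mul_le hb]
    refine ⟨fun h => h.2, fun h => ⟨?_, h⟩⟩
    have := Nat.le_mul_of_pos_right (q + 1) hb
    exact Nat.lt_of_succ_le (this.trans h)
  rw [this, Finset.card_range]

theorem eval_mod (a b : Expr A) (hb : 0 < b.eval w ρ) :
    (mod a b).eval w ρ = a.eval w ρ % b.eval w ρ := by
  rw [mod, eval_sub, eval_mul, eval_div a b hb]
  have := Nat.div_add_mod (a.eval w ρ) (b.eval w ρ)
  omega

/-- The number of letters before the first one that violates `f`. -/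
def prefixLen (f : Option A → Bool) : Expr A :=
  sum 50 len (eq (sum 51 (add (var 50) one) (not (sym f (var 51)))) (lit 0))

theorem eval_prefixLen (f : Option A → Bool) (hρ : ρ 99 = w.length) {n : ℕ} (hn : n ≤ w.length)
    (h : ∀ i < n, f w[i]? = true) (hn' : n < w.length → f w[n]? = false) :
    (prefixLen f).eval w ρ = n := by
  simp only [prefixLen, len, eval_sum, eval_eq, eval_var, eval_add, eval_one, eval_not, eval_sym,
    eval_lit, hρ, update_self, Finset.sum_eq_zero_iff, Finset.mem_range]
  rw [Finset.sum_boole, Nat.cast_id]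
  have : (Finset.range w.length).filter (fun i => ∀ j < i + 1,
      (if (if f w[j]? = true then 1 else 0) = 0 then 1 else 0) = 0) = Finset.range n := by
    ext i
    simp only [Finset.mem_filter, Finset.mem_range]
    constructor
    · rintro ⟨hi, hall⟩
      by_contra hlt
      have := hall n (by omega)
      simp [hn' (by omega)] at this
    · intro hi
      refine ⟨by omega, fun j hj => ?_⟩
      simp [h j (by omega)]
  rw [this, Finset.card_range]

/-- The value of a bit string whose first bit is the least significant one. -/
def _root_.GrundyDom.bitsValue : List Bool → ℕ
  | [] => 0
  | b :: l => 2 * bitsValue l + b.toNat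

/-- Horner's scheme with the values capped at `C`; the step writes `min C t` as `C - (C - t)`. -/
theorem descend_bits (C : ℕ) (l : List Bool) :
    descend (fun i a => C - (C - (2 * a + (l[i]?.getD false).toNat))) l.length 0 =
      min C (bitsValue l) := by
  have key : ∀ m ≤ l.length, descend (fun i a => C - (C - (2 * a + (l[i]?.getD false).toNat))) m
      (min C (bitsValue (l.drop m))) = min C (bitsValue l) := by
    intro m
    induction m with
    | zero => exact fun _ => rfl
    | succ m ih =>
      intro hm
      rw [descend, ← ih (by omega)]
      congr 1
      rw [List.drop_eq_getElem_cons (show m < l.length by omega), bitsValue,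
        List.getElem?_eq_getElem (show m < l.length by omega), Option.getD_some]
      omega
  have := key l.length le_rfl
  rwa [List.drop_length, bitsValue, Nat.min_zero] at this

/-- The number with the binary digits given by the letters at the positions `s, …, s + m - 1`,
least significant first, or `c` if that is smaller. -/
def cappedBits (f : Option A → Bool) (s m c : Expr A) : Expr A :=
  fold 52 53 m c (sub c (add (mul (lit 2) (var 53)) (sym f (add s (var 52)))))

theorem eval_cappedBits (f : Option A → Bool) (s m c : Expr A) (l : List Bool)
    (hm : m.eval w ρ = l.length)
    (hs : ∀ i a, s.eval w (update (update ρ 52 i) 53 a) = s.eval w ρ)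
    (hc : ∀ i a, c.eval w (update (update ρ 52 i) 53 a) = c.eval w ρ)
    (hf : ∀ i, f w[s.eval w ρ + i]? = l[i]?.getD false) :
    (cappedBits f s m c).eval w ρ = min (c.eval w ρ) (bitsValue l) := by
  rw [cappedBits, eval, hm, ← descend_bits]
  congr 1
  funext i a
  simp only [eval_sub, eval_add, eval_mul, eval_lit, eval_var, eval_sym, hs, hc, update_self,
    update_of_ne (show 52 ≠ 53 by decide), hf]
  cases l[i]?.getD false <;> rfl

end Expr

end GrundyDom

/-! ### The encoding of instances, letter by letter -/

namespace GrundyDom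

open Function

/-- Adjacency of the vertices with the given numbers, which is false for numbers out of range. -/
def NatAdj {n : ℕ} (G : SimpleGraph (Fin n)) (a b : ℕ) : Prop :=
  ∃ (ha : a < n) (hb : b < n), G.Adj ⟨a, ha⟩ ⟨b, hb⟩

theorem natAdj_val {n : ℕ} (G : SimpleGraph (Fin n)) (a b : Fin n) :
    NatAdj G a b ↔ G.Adj a b :=
  ⟨fun ⟨_, _, h⟩ => h, fun h => ⟨a.2, b.2, h⟩⟩

theorem flatMap_range_map_range {α : Type} (m n : ℕ) (f : ℕ → ℕ → α) :
    ((List.range n).flatMap fun i => (List.range m).map (f i)) =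
      (List.range (n * m)).map fun t => f (t / m) (t % m) := by
  induction n with
  | zero => simp
  | succ n ih =>
    rw [List.range_succ, List.flatMap_append, ih, Nat.succ_mul, List.range_add, List.map_append]
    congr 1
    rw [List.map_map, List.flatMap_singleton]
    refine List.map_congr_left fun j hj => ?_
    rw [List.mem_range] at hj
    have hm : 0 < m := by omega
    simp [Nat.mul_add_div hm, Nat.mul_comm n m, Nat.div_eq_of_lt hj, Nat.mod_eq_of_lt hj]

open scoped Classical in
theorem encodeAdj_eq {n : ℕ} (G : SimpleGraph (Fin n)) :
    encodeAdj G = (List.range (n * n)).map fun t => decide (NatAdj G (t / n) (t % n)) := by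
  rw [← flatMap_range_map_range n n fun a b => decide (NatAdj G a b)]
  have h : ∀ {β : Type} (f : ℕ → β),
      (List.range n).map f = (List.finRange n).map fun i => f i.val := by
    intro β f
    rw [← List.map_coe_finRange_eq_range, List.map_map]
    rfl
  rw [List.flatMap_def, h, ← List.flatMap_def, encodeAdj]
  refine List.flatMap_congr fun i _ => ?_
  rw [h]
  exact List.map_congr_left fun j _ => decide_eq_decide.2 (natAdj_val G i j).symm

theorem bitsValue_encodePosNum (p : PosNum) :
    bitsValue (Computability.encodePosNum p) = (p : ℕ) := by
  induction p with
  | one => rfl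
  | bit0 p ih =>
    rw [Computability.encodePosNum, bitsValue, ih, PosNum.cast_bit0]
    simp
    omega
  | bit1 p ih =>
    rw [Computability.encodePosNum, bitsValue, ih, PosNum.cast_bit1]
    simp
    omega

theorem bitsValue_encodeNat (k : ℕ) : bitsValue (Computability.encodeNat k) = k := by
  have h : ∀ m : Num, bitsValue (Computability.encodeNum m) = (m : ℕ) := by
    rintro (_ | p)
    · rfl
    · exact bitsValue_encodePosNum p
  rw [Computability.encodeNat, h, Num.to_of_nat]

/-- Doubling puts a zero in front of the binary digits, except that `0` has no digits. -/
theorem encodeNat_two_mul (k : ℕ) : Computability.encodeNat (2 * k) =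
    if Computability.encodeNat k = [] then [] else false :: Computability.encodeNat k := by
  have h : ((2 * k : ℕ) : Num) = Num.bit0 k := by
    rw [two_mul, Nat.cast_add, Num.bit0_of_bit0]
  rw [Computability.encodeNat, Computability.encodeNat, h]
  rcases (k : Num) with _ | p
  · rfl
  · have : Computability.encodeNum (Num.pos p) ≠ [] := Computability.encodePosNum_nonempty p
    rw [if_neg this]
    rfl

variable (x : GraphInst)

theorem length_encode : x.encode.length =
    x.n + 1 + x.n * x.n + (Computability.encodeNat x.bound).length := by
  rw [GraphInst.encode]
  simp [length_encodeAdj]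
  omega

theorem getElem?_encode_of_lt {i : ℕ} (hi : i < x.n) : x.encode[i]? = some true := by
  rw [GraphInst.encode, List.getElem?_append_left (by simpa)]
  simp [hi]

theorem getElem?_encode_eq : x.encode[x.n]? = some false := by
  rw [GraphInst.encode, List.getElem?_append_right (by simp)]
  simp

open scoped Classical in
theorem getElem?_encode_adj {t : ℕ} (ht : t < x.n * x.n) :
    x.encode[x.n + 1 + t]? = some (decide (NatAdj x.graph (t / x.n) (t % x.n))) := by
  rw [GraphInst.encode, List.getElem?_append_right (by simp; omega)]
  rw [List.length_replicate, (show x.n + 1 + t - x.n = t + 1 by omega), List.getElem?_cons_succ,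
    List.getElem?_append_left (by rwa [length_encodeAdj]), encodeAdj_eq]
  simp [ht]

open scoped Classical in
theorem getElem?_encode_adj' {a b : ℕ} (ha : a < x.n) (hb : b < x.n) :
    x.encode[x.n + 1 + a * x.n + b]? = some (decide (NatAdj x.graph a b)) := by
  have h : a * x.n + b < x.n * x.n := by
    have := Nat.mul_le_mul_right x.n (Nat.succ_le_of_lt ha)
    rw [Nat.succ_mul] at this
    omega
  have hn : 0 < x.n := by omega
  rw [add_assoc (x.n + 1), getElem?_encode_adj x h]
  simp [Nat.mul_comm a, Nat.mul_add_div hn, Nat.div_eq_of_lt hb, Nat.mod_eq_of_lt hb]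

theorem getElem?_encode_bound (i : ℕ) :
    x.encode[x.n + 1 + x.n * x.n + i]? = (Computability.encodeNat x.bound)[i]? := by
  rw [GraphInst.encode, List.getElem?_append_right (by simp; omega)]
  rw [List.length_replicate,
    (show x.n + 1 + x.n * x.n + i - x.n = x.n * x.n + i + 1 by omega), List.getElem?_cons_succ,
    List.getElem?_append_right (by rw [length_encodeAdj]; omega), length_encodeAdj,
    Nat.add_sub_cancel_left]

/-! ### The encoding of the doubled instance -/

/-- The instance with doubled vertices and doubled bound. -/
def GraphInst.double : GraphInst := ⟨x.n * 2, doubled x.graph, 2 * x.bound⟩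

theorem natAdj_doubled {n : ℕ} (G : SimpleGraph (Fin n)) {a b : ℕ} (ha : a < n * 2)
    (hb : b < n * 2) :
    NatAdj (doubled G) a b ↔ a ≠ b ∧ (a / 2 = b / 2 ∨ NatAdj G (a / 2) (b / 2)) := by
  have ha' : a / 2 < n := by omega
  have hb' : b / 2 < n := by omega
  simp only [NatAdj, ha, hb, ha', hb', exists_true_left]
  refine and_congr (by simp) (or_congr ?_ Iff.rfl)
  simp [Fin.ext_iff, Fin.divNat]

namespace Expr

/-- The number of vertices of the instance. -/
def order : Expr Bool := prefixLen fun a => a == some true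

/-- The number of letters in front of the binary digits of the bound. -/
def header {A : Type} (n : Expr A) : Expr A := add (add n one) (mul n n)

/-- The number of binary digits of the bound. -/
def digits : Expr Bool := sub len (header order)

/-- The length of the encoded doubled instance. -/
def doubleLen : Expr Bool :=
  add (header (mul order (lit 2))) (ite digits (add digits one) (lit 0))

/-- Adjacency of the vertices `t / (2 n)` and `t % (2 n)` in the doubled graph. -/
def doubleAdj (n t : Expr Bool) : Expr Bool :=
  mul (not (eq (div t (mul n (lit 2))) (mod t (mul n (lit 2)))))
    (add (eq (div (div t (mul n (lit 2))) (lit 2)) (div (mod t (mul n (lit 2))) (lit 2)))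
      (sym (fun a => a == some true) (add (add (add n one)
        (mul (div (div t (mul n (lit 2))) (lit 2)) n)) (div (mod t (mul n (lit 2))) (lit 2)))))

/-- The letter of the encoded doubled instance at the position that the variable `0` holds. -/
def doubleBit : Expr Bool :=
  ite (lt (var 0) (mul order (lit 2))) one
    (ite (lt (var 0) (add (mul order (lit 2)) one)) (lit 0)
      (ite (lt (var 0) (header (mul order (lit 2))))
        (doubleAdj order (sub (var 0) (add (mul order (lit 2)) one)))
        (ite (sub (var 0) (header (mul order (lit 2))))
          (sym (fun a => a == some true)
            (add (header order) (sub (sub (var 0) (header (mul order (lit 2)))) one)))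
          (lit 0))))

variable {ρ : ℕ → ℕ}

theorem eval_order (hρ : ρ 99 = x.encode.length) : order.eval x.encode ρ = x.n :=
  eval_prefixLen _ hρ (by rw [length_encode]; omega)
    (fun i hi => by simp [getElem?_encode_of_lt x hi]) fun _ => by simp [getElem?_encode_eq]

theorem eval_digits (hρ : ρ 99 = x.encode.length) :
    digits.eval x.encode ρ = (Computability.encodeNat x.bound).length := by
  simp only [digits, header, len, eval_sub, eval_add, eval_mul, eval_one, eval_var,
    eval_order x hρ]
  rw [hρ, length_encode]
  omega

theorem length_encodeNat_two_mul (k : ℕ) : (Computability.encodeNat (2 * k)).length =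
    if (Computability.encodeNat k).length ≠ 0 then (Computability.encodeNat k).length + 1
    else 0 := by
  rw [encodeNat_two_mul]
  split_ifs <;> simp_all

theorem eval_doubleLen (hρ : ρ 99 = x.encode.length) :
    doubleLen.eval x.encode ρ = x.double.encode.length := by
  rw [length_encode, GraphInst.double]
  simp only [doubleLen, header, eval_add, eval_mul, eval_one, eval_ite, eval_lit,
    eval_order x hρ, eval_digits x hρ, length_encodeNat_two_mul]

theorem eval_doubleAdj {w : List Bool} {n t : Expr Bool} {N T : ℕ} (hN : n.eval w ρ = N)
    (hT : t.eval w ρ = T) (h0 : 0 < N) :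
    (doubleAdj n t).eval w ρ ≠ 0 ↔ T / (N * 2) ≠ T % (N * 2) ∧
      (T / (N * 2) / 2 = T % (N * 2) / 2 ∨
        w[N + 1 + T / (N * 2) / 2 * N + T % (N * 2) / 2]? = some true) := by
  have hm : (mul n (lit 2)).eval w ρ = N * 2 := by rw [eval_mul, hN, eval_lit]
  have hd : (div t (mul n (lit 2))).eval w ρ = T / (N * 2) := by
    rw [eval_div _ _ (by omega), hT, hm]
  have hr : (mod t (mul n (lit 2))).eval w ρ = T % (N * 2) := by
    rw [eval_mod _ _ (by omega), hT, hm]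
  have hd2 : (div (div t (mul n (lit 2))) (lit 2)).eval w ρ = T / (N * 2) / 2 := by
    rw [eval_div _ _ (by simp), hd, eval_lit]
  have hr2 : (div (mod t (mul n (lit 2))) (lit 2)).eval w ρ = T % (N * 2) / 2 := by
    rw [eval_div _ _ (by simp), hr, eval_lit]
  simp [doubleAdj, hd, hr, hd2, hr2, hN]
  tauto

theorem eval_doubleBit (hρ : ρ 99 = x.encode.length) (hi : ρ 0 < x.double.encode.length) :
    x.double.encode[ρ 0]? = some (decide (doubleBit.eval x.encode ρ ≠ 0)) := by
  classical
  generalize hi' : ρ 0 = i at hi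
  have hn : x.double.n = x.n * 2 := rfl
  rw [length_encode, hn] at hi
  have ho := eval_order x hρ
  have hm : (mul order (lit 2)).eval x.encode ρ = x.n * 2 := by rw [eval_mul, ho, eval_lit]
  have hh : (header (mul order (lit 2))).eval x.encode ρ =
      x.n * 2 + 1 + x.n * 2 * (x.n * 2) := by
    rw [header, eval_add, eval_add, eval_mul (mul order _), hm, eval_one]
  rw [doubleBit, eval_ite, eval_lt, eval_var, hm, hi']
  by_cases h₁ : i < x.n * 2
  · simp [h₁, getElem?_encode_of_lt x.double h₁]
  rw [if_neg h₁, if_neg (by simp), eval_ite, eval_lt, eval_add, eval_one, eval_var, hm, hi']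
  by_cases h₂ : i < x.n * 2 + 1
  · obtain rfl : i = x.n * 2 := by omega
    rw [← hn, getElem?_encode_eq]
    simp
  rw [if_neg h₂, if_neg (by simp), eval_ite, eval_lt, eval_var, hh, hi']
  by_cases h₃ : i < x.n * 2 + 1 + x.n * 2 * (x.n * 2)
  · obtain ⟨t, rfl⟩ : ∃ t, i = x.n * 2 + 1 + t := ⟨i - (x.n * 2 + 1), by omega⟩
    have ht : t < x.n * 2 * (x.n * 2) := by omega
    have h0 : 0 < x.n := by
      by_contra h
      obtain h : x.n = 0 := by omega
      simp [h] at ht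
    have ha : t / (x.n * 2) < x.n * 2 := Nat.div_lt_of_lt_mul ht
    have hb : t % (x.n * 2) < x.n * 2 := Nat.mod_lt _ (by omega)
    rw [if_pos h₃, if_pos one_ne_zero, ← hn, getElem?_encode_adj x.double (by rwa [hn])]
    refine congrArg some (decide_eq_decide.2 ?_)
    rw [eval_doubleAdj ho (T := t) (by simp [hm, hi']) h0,
      getElem?_encode_adj' x (by omega) (by omega)]
    exact (natAdj_doubled x.graph ha hb).trans (by simp)
  · obtain ⟨j, rfl⟩ : ∃ j, i = x.n * 2 + 1 + x.n * 2 * (x.n * 2) + j :=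
      ⟨i - (x.n * 2 + 1 + x.n * 2 * (x.n * 2)), by omega⟩
    rw [if_neg h₃, if_neg (by simp), eval_ite, eval_sub, eval_var, hh, hi', Nat.add_sub_cancel_left,
      ← hn, getElem?_encode_bound x.double j]
    have hj : j < (Computability.encodeNat (2 * x.bound)).length := by
      have : x.double.bound = 2 * x.bound := rfl
      rw [this] at hi
      omega
    change (Computability.encodeNat (2 * x.bound))[j]? = _
    rw [encodeNat_two_mul] at hj ⊢
    by_cases hnil : Computability.encodeNat x.bound = []
    · simp [hnil] at hj
    rw [if_neg hnil] at hj ⊢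
    cases j with
    | zero => simp
    | succ j =>
      have hj' : j < (Computability.encodeNat x.bound).length := by simpa using hj
      have e : (add (header order) (sub (sub (var 0) (header (mul order (lit 2)))) one)).eval
          x.encode ρ = x.n + 1 + x.n * x.n + j := by
        rw [eval_add, eval_sub, eval_sub, hh, eval_var, hi', eval_one, header, eval_add, eval_add,
          eval_mul, ho, eval_one]
        omega
      rw [if_pos (by simp), eval_sym, e, getElem?_encode_bound, List.getElem?_cons_succ,
        List.getElem?_eq_getElem hj']
      simp

/-- Doubling vertices and bound is computable in polynomial time. -/
theorem output_double : output doubleLen doubleBit x.encode = x.double.encode := by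
  rw [output]
  refine List.ext_getElem? fun i => ?_
  rw [eval_doubleLen x rfl, List.getElem?_map]
  by_cases hi : i < x.double.encode.length
  · rw [List.getElem?_range hi, Option.map_some]
    exact (eval_doubleBit (ρ := update (fun _ => x.encode.length) 0 i) x
      (update_of_ne (by decide) _ _) (by rwa [update_self])).symm.trans (by rw [update_self])
  · rw [List.getElem?_eq_none (by simpa using hi), List.getElem?_eq_none (by simpa using hi)]
    rfl

end Expr

end GrundyDom

/-! ### The verifier -/

namespace GrundyDom

open Function

/-- The vertex with number `u` is dominated by the vertex with number `v`. -/
def NatDom {n : ℕ} (G : SimpleGraph (Fin n)) (v u : ℕ) : Prop := u = v ∨ NatAdj G v u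

theorem natDom_val {n : ℕ} (G : SimpleGraph (Fin n)) (v u : Fin n) :
    NatDom G v u ↔ u ∈ closedNbhd G v :=
  or_congr Fin.ext_iff.symm (natAdj_val G v u)

/-- The `i`-th entry of the sequence that a certificate stands for: the number of ones in its
`i`-th block of length `n`. -/
def certVertex (n : ℕ) (y : List Bool) (i : ℕ) : ℕ :=
  ∑ v ∈ Finset.range n, if y[i * n + v]? = some true then 1 else 0

open scoped Classical in
/-- The first `k` entries of the certificate `y` form a double neighbourhood sequence. -/
def Accepts {n : ℕ} (G : SimpleGraph (Fin n)) (k : ℕ) (y : List Bool) : Prop :=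
  k ≤ n ∧ (∀ i < k, certVertex n y i < n) ∧
    (∀ i < k, ∀ j < i, certVertex n y j ≠ certVertex n y i) ∧
    ∀ i < k, ∃ u < n, NatDom G (certVertex n y i) u ∧
      ∑ j ∈ Finset.range i, (if NatDom G (certVertex n y j) u then 1 else 0) ≤ 1

open scoped Classical in
/-- Counting dominators along a list whose entries are numbered by `s`. -/
theorem domCount_take {n : ℕ} {G : SimpleGraph (Fin n)} {S : List (Fin n)} {s : ℕ → ℕ}
    (hs : ∀ i (hi : i < S.length), s i = S[i]) (u : Fin n) {i : ℕ} (hi : i ≤ S.length) :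
    domCount G (S.take i) u = ∑ j ∈ Finset.range i, if NatDom G (s j) u then 1 else 0 := by
  induction i with
  | zero => rfl
  | succ i ih =>
    rw [Finset.sum_range_succ, ← ih (by omega), List.take_succ_eq_append_getElem (by omega),
      domCount_append, hs i (by omega)]
    congr 1
    simp only [natDom_val]
    simp only [domCount, List.countP_singleton, decide_eq_true_eq]

/-- Soundness of the verifier, for certificates of any length. -/
theorem Accepts.le_grundyDoubleDominationNumber {n : ℕ} {G : SimpleGraph (Fin n)}
    (hG : ∀ v, ¬ G.IsIsolated v) {k : ℕ} {y : List Bool} (h : Accepts G k y) :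
    k ≤ grundyDoubleDominationNumber G := by
  obtain ⟨-, hlt, hne, hdom⟩ := h
  rw [le_grundyDoubleDominationNumber_iff G hG]
  set S : List (Fin n) := List.ofFn fun i : Fin k => ⟨certVertex n y i, hlt i i.2⟩ with hS
  have hlen : S.length = k := by simp [hS]
  have hs : ∀ i (hi : i < S.length), certVertex n y i = S[i] := by
    intro i hi
    simp [hS]
  refine ⟨S, ⟨?_, fun i hi => ?_⟩, hlen.ge⟩
  · rw [hS, List.nodup_ofFn]
    intro i j hij
    rw [Fin.mk.injEq] at hij
    rcases lt_trichotomy i j with h | h | h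
    · exact absurd hij (hne j j.2 i h)
    · exact h
    · exact absurd hij.symm (hne i i.2 j h)
  · obtain ⟨u, hu, hd, hc⟩ := hdom i (hlen ▸ hi)
    refine ⟨⟨u, hu⟩, (natDom_val G _ _).1 (by rwa [← hs i hi]), ?_⟩
    rw [domCount_take hs _ hi.le]
    exact Nat.lt_succ_of_le hc

/-- Completeness of the verifier: a sequence of length at least `k` is written down in unary,
one block of length `n` for each of its first `k` entries. -/
theorem exists_accepts {n : ℕ} {G : SimpleGraph (Fin n)} (hG : ∀ v, ¬ G.IsIsolated v) {k : ℕ}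
    (h : k ≤ grundyDoubleDominationNumber G) :
    ∃ y : List Bool, y.length ≤ n * n ∧ Accepts G k y := by
  classical
  obtain ⟨S, ⟨hnd, hleg⟩, hk⟩ := (le_grundyDoubleDominationNumber_iff G hG k).1 h
  have hn : S.length ≤ n := by simpa using hnd.length_le_card
  set y : List Bool := (List.range (k * n)).map fun t =>
    decide (∃ h : t / n < S.length, t % n < (S[t / n] : ℕ)) with hc
  have hs : ∀ i (hi : i < (S.take k).length), certVertex n y i = (S.take k)[i] := by
    intro i hi
    rw [List.length_take] at hi
    have hik : i < k := by omega
    have hiS : i < S.length := by omega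
    rw [List.getElem_take, certVertex]
    have hb : ∀ v ∈ Finset.range n, (if y[i * n + v]? = some true then 1 else 0) =
        if v < (S[i] : ℕ) then 1 else 0 := by
      intro v hv
      rw [Finset.mem_range] at hv
      have hn0 : 0 < n := by omega
      have ht : i * n + v < k * n := by
        have := Nat.mul_le_mul_right n (Nat.succ_le_of_lt hik)
        rw [Nat.succ_mul] at this
        omega
      have e₁ : (i * n + v) / n = i := by
        rw [Nat.mul_comm, Nat.mul_add_div hn0, Nat.div_eq_of_lt hv, add_zero]
      have e₂ : (i * n + v) % n = v := by
        rw [Nat.mul_comm, Nat.mul_add_mod, Nat.mod_eq_of_lt hv]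
      rw [hc, List.getElem?_map, List.getElem?_range ht]
      simp [e₁, e₂, hiS]
    rw [Finset.sum_congr rfl hb, Finset.sum_boole, Nat.cast_id]
    have : (Finset.range n).filter (fun v => v < (S[i] : ℕ)) = Finset.range (S[i] : ℕ) := by
      ext v
      have := S[i].2
      simp only [Finset.mem_filter, Finset.mem_range]
      omega
    rw [this, Finset.card_range]
  have hlk : (S.take k).length = k := by rw [List.length_take]; omega
  refine ⟨y, ?_, by omega, fun i hi => ?_, fun i hi j hj => ?_, fun i hi => ?_⟩
  · rw [hc, List.length_map, List.length_range]
    exact Nat.mul_le_mul_right n (by omega)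
  · rw [hs i (by omega)]
    exact Fin.is_lt _
  · rw [hs i (by omega), hs j (by omega)]
    intro h
    have := (hnd.sublist (List.take_sublist k S)).getElem_inj_iff.1 (Fin.ext h)
    omega
  · obtain ⟨u, hu, hcnt⟩ := hleg.take k i (by omega)
    refine ⟨u, u.2, ?_, ?_⟩
    · rw [hs i (by omega)]
      exact (natDom_val G _ _).2 hu
    · rw [domCount_take hs u (by omega)] at hcnt
      omega

namespace Expr

variable {A : Type} {w : List A} {ρ : ℕ → ℕ}

/-- Bounded universal quantification. -/
def all (x : ℕ) (n b : Expr A) : Expr A := not (sum x n (not b))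

theorem eval_all_ne_zero (x : ℕ) (n b : Expr A) : (all x n b).eval w ρ ≠ 0 ↔
    ∀ i < n.eval w ρ, b.eval w (update ρ x i) ≠ 0 := by
  simp [all]

theorem eval_sum_ne_zero (x : ℕ) (n b : Expr A) : (sum x n b).eval w ρ ≠ 0 ↔
    ∃ i < n.eval w ρ, b.eval w (update ρ x i) ≠ 0 := by
  simp [Finset.sum_eq_zero_iff]

theorem eval_mul_ne_zero (a b : Expr A) : (mul a b).eval w ρ ≠ 0 ↔
    a.eval w ρ ≠ 0 ∧ b.eval w ρ ≠ 0 := by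
  simp

/-- The number of vertices of the instance in front of a certificate. -/
def certOrder : Expr (Bool ⊕ Bool) := prefixLen fun a => decide (a = some (Sum.inl true))

/-- The position at which the certificate starts. -/
def certStart : Expr (Bool ⊕ Bool) := prefixLen fun a => a.any Sum.isLeft

/-- The bound of the instance, capped at the number of vertices plus one. The bound itself may be
exponential in the length of the word, but bounds above the number of vertices are rejected. -/
def certBound : Expr (Bool ⊕ Bool) :=
  cappedBits (fun a => decide (a = some (Sum.inl true))) (header certOrder)
    (sub certStart (header certOrder)) (add certOrder one)

/-- The entry with number `i` of the sequence. The variable `10` must not occur in `i`. -/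
def certEntry (i : Expr (Bool ⊕ Bool)) : Expr (Bool ⊕ Bool) :=
  sum 10 certOrder (sym (fun a => decide (a = some (Sum.inr true)))
    (add certStart (add (mul i certOrder) (var 10))))

/-- The vertex `u` is dominated by the vertex `v`: equality or the matrix entry `v n + u`. -/
def certDom (v u : Expr (Bool ⊕ Bool)) : Expr (Bool ⊕ Bool) :=
  add (eq u v) (sym (fun a => decide (a = some (Sum.inl true)))
    (add (add (add certOrder one) (mul v certOrder)) u))

/-- The condition `Accepts`. The variables `0` and `1` number entries of the sequence, and the
variable `2` is a footprint. -/
def verifier : Expr (Bool ⊕ Bool) :=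
  mul (le certBound certOrder)
    (mul (all 0 certBound (lt (certEntry (var 0)) certOrder))
      (mul (all 0 certBound (all 1 (var 0) (not (eq (certEntry (var 1)) (certEntry (var 0))))))
        (all 0 certBound (sum 2 certOrder (mul (certDom (certEntry (var 0)) (var 2))
          (le (sum 1 (var 0) (not (not (certDom (certEntry (var 1)) (var 2))))) one))))))

/-- The word that consists of an instance and a certificate. -/
noncomputable def _root_.GrundyDom.certWord (x : GraphInst) (y : List Bool) : List (Bool ⊕ Bool) :=
  x.encode.map Sum.inl ++ y.map Sum.inr

variable (x : GraphInst) (y : List Bool)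

theorem getElem?_certWord_left {i : ℕ} (hi : i < x.encode.length) :
    (certWord x y)[i]? = x.encode[i]?.map Sum.inl := by
  rw [certWord, List.getElem?_append_left (by simpa), List.getElem?_map]

theorem getElem?_certWord_right (i : ℕ) :
    (certWord x y)[x.encode.length + i]? = y[i]?.map Sum.inr := by
  rw [certWord, List.getElem?_append_right (by simp), List.getElem?_map]
  simp

theorem length_certWord : (certWord x y).length = x.encode.length + y.length := by
  simp [certWord]

variable {x y}

theorem eval_certOrder (hρ : ρ 99 = (certWord x y).length) :
    certOrder.eval (certWord x y) ρ = x.n := by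
  have hl := length_encode x
  refine eval_prefixLen _ hρ (by rw [length_certWord]; omega) (fun i hi => ?_) fun _ => ?_
  · rw [getElem?_certWord_left x y (by omega), getElem?_encode_of_lt x hi]
    rfl
  · rw [getElem?_certWord_left x y (by omega), getElem?_encode_eq]
    rfl

theorem eval_certStart (hρ : ρ 99 = (certWord x y).length) :
    certStart.eval (certWord x y) ρ = x.encode.length := by
  refine eval_prefixLen _ hρ (by rw [length_certWord]; omega) (fun i hi => ?_) fun _ => ?_
  · rw [getElem?_certWord_left x y hi, List.getElem?_eq_getElem hi]
    rfl
  · rw [← add_zero x.encode.length, getElem?_certWord_right]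
    cases y <;> rfl

theorem eval_certBound (hρ : ρ 99 = (certWord x y).length) :
    certBound.eval (certWord x y) ρ = min (x.n + 1) x.bound := by
  have hh : ∀ ρ : ℕ → ℕ, ρ 99 = (certWord x y).length →
      (header certOrder).eval (certWord x y) ρ = x.n + 1 + x.n * x.n := by
    intro ρ hρ
    simp [header, eval_certOrder hρ]
  have hu : ∀ i a, update (update ρ 52 i) 53 a 99 = (certWord x y).length := by
    intro i a
    simp [hρ]
  rw [certBound, eval_cappedBits _ _ _ _ (Computability.encodeNat x.bound), bitsValue_encodeNat]
  · simp [eval_certOrder hρ]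
  · rw [eval_sub, eval_certStart hρ, hh ρ hρ, length_encode]
    omega
  · exact fun i a => (hh _ (hu i a)).trans (hh ρ hρ).symm
  · intro i a
    rw [eval_add, eval_add, eval_certOrder hρ, eval_certOrder (hu i a), eval_one, eval_one]
  · intro i
    have hl := length_encode x
    rw [hh ρ hρ]
    by_cases hi : i < (Computability.encodeNat x.bound).length
    · rw [getElem?_certWord_left x y (by omega), getElem?_encode_bound,
        List.getElem?_eq_getElem hi]
      cases (Computability.encodeNat x.bound)[i] <;> rfl
    · obtain ⟨j, rfl⟩ : ∃ j, i = (Computability.encodeNat x.bound).length + j :=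
        ⟨i - (Computability.encodeNat x.bound).length, by omega⟩
      have e : (Computability.encodeNat x.bound)[(Computability.encodeNat x.bound).length + j]? =
          none := List.getElem?_eq_none (by omega)
      rw [← add_assoc, ← hl, getElem?_certWord_right, e]
      cases y[j]? <;> rfl

theorem eval_certEntry (hρ : ρ 99 = (certWord x y).length) {i : ℕ} {e : Expr (Bool ⊕ Bool)}
    (he : ∀ v, e.eval (certWord x y) (update ρ 10 v) = i) :
    (certEntry e).eval (certWord x y) ρ = certVertex x.n y i := by
  have hu : ∀ v, update ρ 10 v 99 = (certWord x y).length := by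
    intro v
    simp [hρ]
  rw [certEntry, eval_sum, eval_certOrder hρ, certVertex]
  refine Finset.sum_congr rfl fun v _ => ?_
  rw [eval_sym, eval_add, eval_add, eval_mul, eval_certOrder (hu v), eval_certStart (hu v), he,
    eval_var, update_self, getElem?_certWord_right]
  cases y[i * x.n + v]? with
  | none => rfl
  | some b => cases b <;> rfl

theorem eval_certDom (hρ : ρ 99 = (certWord x y).length) {e f : Expr (Bool ⊕ Bool)} {v u : ℕ}
    (he : e.eval (certWord x y) ρ = v) (hf : f.eval (certWord x y) ρ = u) (hv : v < x.n)
    (hu : u < x.n) : (certDom e f).eval (certWord x y) ρ ≠ 0 ↔ NatDom x.graph v u := by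
  classical
  have hl := length_encode x
  have hlt : x.n + 1 + v * x.n + u < x.encode.length := by
    have := Nat.mul_le_mul_right x.n (Nat.succ_le_of_lt hv)
    rw [Nat.succ_mul] at this
    omega
  rw [certDom, eval_add, eval_eq, eval_sym, eval_add, eval_add, eval_add, eval_mul, he, hf,
    eval_certOrder hρ, eval_one, getElem?_certWord_left x y hlt, getElem?_encode_adj' x hv hu,
    NatDom]
  by_cases h : NatAdj x.graph v u <;> simp [h]

theorem eval_verifier (hρ : ρ 99 = (certWord x y).length) :
    verifier.eval (certWord x y) ρ ≠ 0 ↔ Accepts x.graph x.bound y := by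
  classical
  have h₀ : ∀ i, update ρ 0 i 99 = (certWord x y).length := fun i => by simp [hρ]
  have h₁ : ∀ i j, update (update ρ 0 i) 1 j 99 = (certWord x y).length := fun i j => by simp [hρ]
  have h₂ : ∀ i u, update (update ρ 0 i) 2 u 99 = (certWord x y).length := fun i u => by simp [hρ]
  have h₃ : ∀ i u j, update (update (update ρ 0 i) 2 u) 1 j 99 = (certWord x y).length :=
    fun i u j => by simp [hρ]
  rw [verifier, eval_mul_ne_zero, eval_mul_ne_zero, eval_mul_ne_zero, Accepts, eval_le,
    eval_certBound hρ, eval_certOrder hρ]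
  have hA : ((if min (x.n + 1) x.bound ≤ x.n then 1 else 0) ≠ 0) ↔ x.bound ≤ x.n := by
    split_ifs with h <;> simp <;> omega
  rw [hA]
  refine and_congr_right fun hk => ?_
  have hb : certBound.eval (certWord x y) ρ = x.bound := by
    rw [eval_certBound hρ]
    omega
  simp only [eval_all_ne_zero, hb]
  have hB : (∀ i < x.bound, (lt (certEntry (var 0)) certOrder).eval (certWord x y)
      (update ρ 0 i) ≠ 0) ↔ ∀ i < x.bound, certVertex x.n y i < x.n :=
    forall₂_congr fun i _ => by
      rw [eval_lt, eval_certOrder (h₀ i), eval_certEntry (h₀ i) (i := i) (fun v => by simp)]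
      simp
  rw [hB]
  refine and_congr_right fun hlt => and_congr (forall₂_congr fun i hi => ?_)
    (forall₂_congr fun i hi => ?_)
  · simp only [eval_var, update_self]
    refine forall₂_congr fun j _ => ?_
    rw [eval_not, eval_eq, eval_certEntry (h₁ i j) (i := j) (fun v => by simp),
      eval_certEntry (h₁ i j) (i := i) (fun v => by simp)]
    simp
  · rw [eval_sum_ne_zero, eval_certOrder (h₀ i)]
    refine exists_congr fun u => and_congr_right fun hu => ?_
    rw [eval_mul_ne_zero, eval_certDom (h₂ i u) (eval_certEntry (h₂ i u) (i := i)
      (fun v => by simp)) (by simp) (hlt i hi) hu]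
    refine and_congr_right fun _ => ?_
    rw [eval_le, eval_sum, eval_one]
    have e : (var 0 : Expr (Bool ⊕ Bool)).eval (certWord x y) (update (update ρ 0 i) 2 u) = i := by
      simp
    rw [e]
    have hsum : ∀ j ∈ Finset.range i, (not (not (certDom (certEntry (var 1)) (var 2)))).eval
        (certWord x y) (update (update (update ρ 0 i) 2 u) 1 j) =
        if NatDom x.graph (certVertex x.n y j) u then 1 else 0 := by
      intro j hj
      rw [Finset.mem_range] at hj
      have := eval_certDom (h₃ i u j) (eval_certEntry (h₃ i u j) (i := j) (e := var 1)
        (fun v => by simp)) (f := var 2) (u := u) (by simp) (hlt j (by omega)) hu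
      rw [← this, eval_not, eval_not]
      split_ifs <;> simp_all
    rw [Finset.sum_congr rfl hsum]
    simp

end Expr

end GrundyDom

/-! ### The reduction and NP-completeness -/

namespace GrundyDom

open Turing Function

variable {F : GraphClass}

/-- The reduction: every vertex gets one true twin, and the bound is doubled. -/
def doublingReduction (hF : F.ClosedUnderTrueTwins) (x : (grundyDominationOn F).Inst) :
    (grundyDoubleDominationOn F).Inst :=
  ⟨⟨GraphInst.double x.1, not_isIsolated_doubled _⟩, mem_doubled _ hF x.2⟩

theorem isPolyReduction_doublingReduction (hF : F.ClosedUnderTrueTwins) :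
    IsPolyReduction (grundyDominationOn F) (grundyDoubleDominationOn F)
      (doublingReduction hF) :=
  ⟨Expr.nonempty_computableInPolyTime Expr.doubleLen Expr.doubleBit fun x =>
    (Expr.output_double (GraphInst.mk x.1.n x.1.graph x.1.bound)).symm,
    fun x => (le_grundy_doubled_iff x.1.graph x.1.bound).symm⟩

theorem inNP_grundyDoubleDominationOn (F : GraphClass) : InNP (grundyDoubleDominationOn F) := by
  classical
  refine ⟨fun x => decide (Accepts x.1.1.1.graph x.1.1.1.bound x.2), Polynomial.X ^ 2,
    Expr.nonempty_computableInPolyTime Expr.one Expr.verifier fun x => ?_, fun x => ?_⟩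
  · have h := Expr.eval_verifier (x := x.1.1.1) (y := x.2)
      (ρ := update (fun _ => (certWord x.1.1.1 x.2).length) 0 0) (update_of_ne (by decide) _ _)
    exact congrArg (fun b : Bool => [b]) (decide_eq_decide.2 h.symm)
  · refine ⟨fun hx => ?_, fun ⟨y, _, h⟩ =>
      Accepts.le_grundyDoubleDominationNumber x.1.2 (of_decide_eq_true h)⟩
    obtain ⟨y, hy, h⟩ := exists_accepts x.1.2 hx
    refine ⟨y, hy.trans ?_, decide_eq_true h⟩
    have hn : x.1.1.n ≤ x.1.1.encode.length := by
      rw [length_encode]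
      omega
    rw [Polynomial.eval_pow, Polynomial.eval_X, sq]
    exact Nat.mul_le_mul hn hn

theorem NPHard.of_isPolyReduction {P Q : DecisionProblem} {r : P.Inst → Q.Inst} (hP : NPHard P)
    (hr : IsPolyReduction P Q r) : NPHard Q := by
  intro L hL
  obtain ⟨s, ⟨hs⟩, hs'⟩ := hP L hL
  obtain ⟨⟨hr⟩, hr'⟩ := hr
  exact ⟨r ∘ s, nonempty_computableInPolyTime_comp hs hr, fun x => (hs' x).trans (hr' _)⟩

end GrundyDom

theorem mainTheorem6 (F : GrundyDom.GraphClass) (hF : F.ClosedUnderTrueTwins) :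
    (∃ r : (GrundyDom.grundyDominationOn F).Inst → (GrundyDom.grundyDoubleDominationOn F).Inst,
      GrundyDom.IsPolyReduction (GrundyDom.grundyDominationOn F)
        (GrundyDom.grundyDoubleDominationOn F) r ∧
      ∀ x : (GrundyDom.grundyDominationOn F).Inst,
        Nonempty ((GrundyDom.grundyDoubleDominationOn.toGraphInst (r x)).graph ≃g
          GrundyDom.addTrueTwins (GrundyDom.grundyDominationOn.toGraphInst x).graph
            (fun _ => 1)) ∧
        (GrundyDom.grundyDoubleDominationOn.toGraphInst (r x)).bound =
          2 * (GrundyDom.grundyDominationOn.toGraphInst x).bound) ∧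
    (GrundyDom.NPComplete (GrundyDom.grundyDominationOn F) →
      GrundyDom.NPComplete (GrundyDom.grundyDoubleDominationOn F)) :=
  have h := GrundyDom.isPolyReduction_doublingReduction hF
  ⟨⟨_, h, fun _ => ⟨GrundyDom.nonempty_doubled_iso _, rfl⟩⟩,
    fun hP => ⟨GrundyDom.inNP_grundyDoubleDominationOn F, hP.2.of_isPolyReduction h⟩⟩
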